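/- Let $n\ge 1$ be an integer and $\delta\in\mathbb{C}^{\times}$. An $n$-diagram (up to isotopy) is a way of joining two by two, without crossings and inside a rectangle, $n$ points marked on the bottom side and $n$ points marked on the top side, both numbered $1,\dots,n$ from left to right; that is, a non-crossing perfect matching of these $2n$ boundary points. Let $D_n$ be the set of $n$-diagrams. For $d,e\in D_n$ place $e$ on top of $d$, identifying the top points of $d$ with the bottom points of $e$; deleting the $b(d,e)$ closed loops (bubbles) which appear leaves an $n$-diagram $d\ast e$. Let $\mathbf 1$ be the diagram whose links join the points of equal index on the two sides, and for $1\le i\le n-1$ let $E_i$ be the diagram joining the points $i$ and $i+1$ on the bottom side, joining the points $i$ and $i+1$ on the top side, and otherwise joining points of equal index on the two sides. The diagrammatic algebra $\mathcal D_n(\delta)$ is the $\mathbb{C}$-vector space with basis $D_n$, with the bilinear product $d\cdot e=\delta^{b(d,e)}\,(d\ast e)$ for $d,e\in D_n$ and unit $\mathbf 1$. The monoid of diagrams with bubbles is $\{\mathcal T^p d: p\in\mathbb N,\ d\in D_n\}$ (formal expressions, identified only when both $p$ and $d$ agree), with product $(\mathcal T^p d)(\mathcal T^q e)=\mathcal T^{p+q+b(d,e)}(d\ast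 e)$ and unit $\mathcal T^0\mathbf 1$; a diagram $d$ is identified with $\mathcal T^0 d$, and $\mathcal T=\mathcal T^1\mathbf 1$. A Jones normal form is given by $p\in\mathbb{N}$, $r\ge 0$ and indices $1\le i_1<\dots<i_r\le n-1$, $1\le j_1<\dots<j_r\le n-1$ with $j_k\le i_k$ for all $k$; it is the product $$\mathcal T^p\,(E_{i_1}E_{i_1-1}\cdots E_{j_1})\cdots(E_{i_r}E_{i_r-1}\cdots E_{j_r}),$$ and it is said to be without factor $\mathcal T$ if $p=0$ (for $p=r=0$ it is $\mathbf 1$). Then: 1. (Uniqueness) If two Jones normal forms are equal in the monoid of diagrams with bubbles, then they have the same $p$, the same $r$ and the same indices $i_k$, $j_k$. 2. Every $n$-diagram is equal, in the monoid of diagrams with bubbles, to exactly one Jones normal form without factor $\mathcal T$. 3. (Basis) The products $(E_{i_1}\cdots E_{j_1})\cdots(E_{i_r}\cdots E_{j_r})$ computed in $\mathcal D_n(\delta)$, indexed by the Jones normal forms without factor $\mathcal T$, form a basis of the $\mathbb C$-vector space $\mathcal D_n(\delta)$. -/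

import Mathlib

namespace TemperleyLieb

/-- The `2 * n` marked points of the rectangle: `Sum.inl i` is the `i`-th point of the bottom side and
`Sum.inr i` the `i`-th point of the top side, counted from left to right (from `0`). -/
abbrev Point (n : ℕ) : Type := Fin n ⊕ Fin n

/-- Position of a marked point when one walks around the boundary of the rectangle: the bottom side
from left to right, then the top side from right to left. -/
def pos {n : ℕ} : Point n → ℕ
  | Sum.inl i => i
  | Sum.inr i => 2 * n - 1 - i

/-- An `n`-diagram up to isotopy: the marked points are joined two by two (each point `a` to
`link a`), and no two links cross. -/
@[ext]
structure Diagram (n : ℕ) where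
  link : Point n → Point n
  link_link : ∀ a, link (link a) = a
  link_ne : ∀ a, link a ≠ a
  noncrossing : ∀ a b, ¬ (pos a < pos b ∧ pos b < pos (link a) ∧ pos (link a) < pos (link b))

/-- The points of two rectangles placed on top of each other: the bottom side, the common side and
the top side. -/
inductive Stack (n : ℕ) : Type
  | bot (i : Fin n) : Stack n
  | mid (i : Fin n) : Stack n
  | top (i : Fin n) : Stack n

namespace Stack

variable {n : ℕ}

/-- The marked points of the lower rectangle. -/
def lower : Point n → Stack n
  | Sum.inl i => bot i
  | Sum.inr i => mid i

/-- The marked points of the upper rectangle. -/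
def upper : Point n → Stack n
  | Sum.inl i => mid i
  | Sum.inr i => top i

/-- The marked points of the rectangle obtained after compression. -/
def outer : Point n → Stack n
  | Sum.inl i => bot i
  | Sum.inr i => top i

end Stack

namespace Diagram

variable {n : ℕ}

/-- Two points of the stack (`d` below, `e` above) are joined by a link of `d` or of `e`. -/
def Joined (d e : Diagram n) (x y : Stack n) : Prop :=
  (∃ a, x = Stack.lower a ∧ y = Stack.lower (d.link a)) ∨
    (∃ a, x = Stack.upper a ∧ y = Stack.upper (e.link a))

/-- Two points of the stack (`d` below, `e` above) are connected by a sequence of links. -/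
def conn (d e : Diagram n) : Setoid (Stack n) := Relation.EqvGen.setoid (Joined d e)

/-- The number of bubbles of the stack (`d` below, `e` above): the number of connected components
all of whose points lie on the common side. -/
noncomputable def bubbles (d e : Diagram n) : ℕ :=
  Set.ncard {c : Quotient (conn d e) | ∀ x, Quotient.mk (conn d e) x = c → ∃ i, x = Stack.mid i}

end Diagram

end TemperleyLieb

namespace TemperleyLieb
open Relation

theorem dihedral {X : Type*} [Finite X] (σ τ : Equiv.Perm X) (hσ : ∀ x, σ (σ x) = x)
    (hτ : ∀ x, τ (τ x) = x) (hd : ∀ x, ¬ (σ x = x ∧ τ x = x)) (p : X) (hp : τ p = p) :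
    ∃ q, q ≠ p ∧ EqvGen (fun x y => y = σ x ∨ y = τ x) p q ∧ (σ q = q ∨ τ q = q) ∧
      ∀ r, r ≠ p → EqvGen (fun x y => y = σ x ∨ y = τ x) p r → (σ r = r ∨ τ r = r) → r = q := by
  set ρ : Equiv.Perm X := τ * σ with hρ
  have hσ' : σ * σ = 1 := by ext x; simp [hσ]
  have hτ' : τ * τ = 1 := by ext x; simp [hτ]
  have hσi : σ⁻¹ = σ := inv_eq_of_mul_eq_one_left hσ'
  have hτi : τ⁻¹ = τ := inv_eq_of_mul_eq_one_left hτ'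
  have hinv : ρ⁻¹ = σ * τ := by rw [hρ, mul_inv_rev, hσi, hτi]
  have hc1 : τ * ρ * τ⁻¹ = ρ⁻¹ := by
    rw [hinv, hτi, hρ, ← mul_assoc, hτ', one_mul]
  have e1 : ∀ k : ℤ, τ ((ρ ^ k) p) = (ρ ^ (-k)) p := by
    intro k
    have : τ * ρ ^ k * τ⁻¹ = ρ ^ (-k) := by
      rw [← conj_zpow, hc1, inv_zpow']
    have h2 := congrArg (fun f : Equiv.Perm X => f p) this
    simpa [hτi, hp] using h2
  have hs : σ = τ * ρ := by rw [hρ, ← mul_assoc, hτ', one_mul]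
  have e2 : ∀ k : ℤ, σ ((ρ ^ k) p) = (ρ ^ (-(k+1))) p := by
    intro k
    rw [← e1 (k+1), hs, add_comm k 1, zpow_add, zpow_one]; rfl
  have hj : ∀ k : ℤ, EqvGen (fun x y => y = σ x ∨ y = τ x) p ((ρ ^ k) p) := by
    have stepσ : ∀ x, EqvGen (fun x y => y = σ x ∨ y = τ x) x (σ x) := fun x => .rel _ _ (.inl rfl)
    have stepτ : ∀ x, EqvGen (fun x y => y = σ x ∨ y = τ x) x (τ x) := fun x => .rel _ _ (.inr rfl)
    intro k
    induction k with
    | zero => exact .refl _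
    | succ k ih =>
      rw [add_comm, zpow_add, zpow_one]
      exact (ih.trans _ _ _ (stepσ _)).trans _ _ _ (stepτ _)
    | pred k ih =>
      rw [sub_eq_neg_add, zpow_add, zpow_neg_one, hinv]
      exact (ih.trans _ _ _ (stepτ _)).trans _ _ _ (stepσ _)
  have horb : ∀ r, EqvGen (fun x y => y = σ x ∨ y = τ x) p r → ∃ k : ℤ, r = (ρ ^ k) p := by
    have key : ∀ x y, EqvGen (fun x y => y = σ x ∨ y = τ x) x y →
        ((∃ k : ℤ, x = (ρ ^ k) p) ↔ ∃ k : ℤ, y = (ρ ^ k) p) := by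
      intro x y h
      induction h with
      | rel x y h =>
        constructor
        · rintro ⟨k, rfl⟩
          rcases h with rfl | rfl
          exacts [⟨_, e2 k⟩, ⟨_, e1 k⟩]
        · rintro ⟨k, hk⟩
          rcases h with h | h
          · exact ⟨_, by rw [← e2 k, ← hk, h, hσ]⟩
          · exact ⟨_, by rw [← e1 k, ← hk, h, hτ]⟩
      | refl x => rfl
      | symm x y _ ih => exact ih.symm
      | trans x y z _ _ h1 h2 => exact h1.trans h2
    intro r h
    exact (key p r h).1 ⟨0, rfl⟩
  set N : ℕ := Function.minimalPeriod (ρ • ·) p with hN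
  have hper : ∀ k : ℤ, (ρ ^ k) p = p ↔ (N : ℤ) ∣ k := fun k =>
    MulAction.zpow_smul_eq_iff_minimalPeriod_dvd (a := ρ) (b := p) (n := k)
  have heq : ∀ k l : ℤ, (ρ ^ k) p = (ρ ^ l) p ↔ (N : ℤ) ∣ k - l := by
    intro k l
    rw [← hper, sub_eq_neg_add, zpow_add, Equiv.Perm.mul_apply, zpow_neg, Equiv.Perm.inv_eq_iff_eq]
  have hN0 : 0 < N := by
    obtain ⟨m, hm, h⟩ := isOfFinOrder_iff_pow_eq_one.1 (isOfFinOrder_of_finite ρ)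
    rcases Nat.eq_zero_or_pos N with h0 | h0
    · have := (hper m).1 (by rw [zpow_natCast, h]; rfl)
      rw [h0] at this
      simp at this; omega
    · exact h0
  have hN1 : N ≠ 1 := by
    intro h1
    apply hd p
    refine ⟨?_, hp⟩
    have := e2 0
    simp only [zpow_zero, Equiv.Perm.coe_one, id] at this
    rw [this, hper, h1]; simp
  have fτ : ∀ k : ℤ, τ ((ρ ^ k) p) = (ρ ^ k) p ↔ (N : ℤ) ∣ 2 * k := by
    intro k
    rw [e1, heq, ← dvd_neg]; ring_nf
  have fσ : ∀ k : ℤ, σ ((ρ ^ k) p) = (ρ ^ k) p ↔ (N : ℤ) ∣ 2 * k + 1 := by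
    intro k
    rw [e2, heq, ← dvd_neg]; ring_nf
  obtain ⟨m, hm | hm⟩ := Nat.even_or_odd' N
  · refine ⟨(ρ ^ (m : ℤ)) p, ?_, hj _, .inr ((fτ _).2 ⟨1, by omega⟩), ?_⟩
    · rw [Ne, hper]
      rintro ⟨c, hc⟩
      have : (m : ℤ) * (2 * c - 1) = 0 := by rw [hm] at hc; push_cast at hc; linarith
      rcases mul_eq_zero.1 this with h | h <;> omega
    · intro r hr h1 h2
      obtain ⟨k, rfl⟩ := horb r h1
      rw [fσ, fτ] at h2
      rw [Ne, hper] at hr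
      rw [heq]
      have h3 : (N : ℤ) ∣ 2 * k := by
        rcases h2 with ⟨c, hc⟩ | h2
        · rw [hm] at hc; push_cast at hc
          have : 2 * (m * c - k) = 1 := by linarith
          omega
        · exact h2
      obtain ⟨c, hc⟩ := h3
      rw [hm] at hc hr ⊢; push_cast at hc hr ⊢
      have hk : k = m * c := by linarith
      obtain ⟨a, rfl | rfl⟩ := Int.even_or_odd' c
      · exact absurd ⟨a, by rw [hk]; ring⟩ hr
      · exact ⟨a, by rw [hk]; ring⟩
  · refine ⟨(ρ ^ (m : ℤ)) p, ?_, hj _, .inl ((fσ _).2 ⟨1, by omega⟩), ?_⟩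
    · rw [Ne, hper]
      intro h
      have := Int.le_of_dvd (by omega) h
      omega
    · intro r hr h1 h2
      obtain ⟨k, rfl⟩ := horb r h1
      rw [fσ, fτ] at h2
      rw [Ne, hper] at hr
      rw [heq]
      have hcop : IsCoprime (N : ℤ) 2 := ⟨1, -m, by rw [hm]; push_cast; ring⟩
      rcases h2 with h2 | h2
      · apply hcop.dvd_of_dvd_mul_left
        have : 2 * (k - m) = (2 * k + 1) - N := by rw [hm]; push_cast; ring
        rw [this]; exact dvd_sub_self_right.2 h2
      · exact absurd (hcop.dvd_of_dvd_mul_left h2) hr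

end TemperleyLieb

namespace TemperleyLieb
open Relation

namespace Stack
variable {n : ℕ}

instance : Finite (Stack n) := by
  refine Finite.of_injective (β := Fin n ⊕ Fin n ⊕ Fin n)
    (fun x => match x with
      | bot i => .inl i
      | mid i => .inr (.inl i)
      | top i => .inr (.inr i)) ?_
  intro x y h
  cases x <;> cases y <;> simp_all

theorem lower_injective : Function.Injective (lower (n := n)) := by
  rintro (a | a) (b | b) h <;> simp_all [lower]

theorem upper_injective : Function.Injective (upper (n := n)) := by
  rintro (a | a) (b | b) h <;> simp_all [upper]

theorem outer_injective : Function.Injective (outer (n := n)) := by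
  rintro (a | a) (b | b) h <;> simp_all [outer]

end Stack

open Stack

namespace Diagram
variable {n : ℕ}

/-- Follow the link of the lower diagram `d`; the top side is fixed. -/
def lowerMap (d : Diagram n) : Stack n → Stack n
  | bot i => lower (d.link (Sum.inl i))
  | mid i => lower (d.link (Sum.inr i))
  | top i => top i

/-- Follow the link of the upper diagram `e`; the bottom side is fixed. -/
def upperMap (e : Diagram n) : Stack n → Stack n
  | bot i => bot i
  | mid i => upper (e.link (Sum.inl i))
  | top i => upper (e.link (Sum.inr i))

theorem lowerMap_lower (d : Diagram n) (a : Point n) : d.lowerMap (lower a) = lower (d.link a) := by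
  rcases a with a | a <;> rfl

theorem upperMap_upper (d : Diagram n) (a : Point n) : d.upperMap (upper a) = upper (d.link a) := by
  rcases a with a | a <;> rfl

theorem lowerMap_lowerMap (d : Diagram n) (x : Stack n) : d.lowerMap (d.lowerMap x) = x := by
  cases x with
  | bot i => exact (lowerMap_lower d _).trans (by rw [d.link_link]; rfl)
  | mid i => exact (lowerMap_lower d _).trans (by rw [d.link_link]; rfl)
  | top i => rfl

theorem upperMap_upperMap (d : Diagram n) (x : Stack n) : d.upperMap (d.upperMap x) = x := by
  cases x with
  | bot i => rfl
  | mid i => exact (upperMap_upper d _).trans (by rw [d.link_link]; rfl)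
  | top i => exact (upperMap_upper d _).trans (by rw [d.link_link]; rfl)

theorem lowerMap_eq_self (d : Diagram n) (x : Stack n) : d.lowerMap x = x ↔ ∃ i, x = top i := by
  cases x with
  | bot i => exact ⟨fun h => absurd (lower_injective (a₂ := Sum.inl i) h) (d.link_ne _), fun ⟨_, h⟩ => nomatch h⟩
  | mid i => exact ⟨fun h => absurd (lower_injective (a₂ := Sum.inr i) h) (d.link_ne _), fun ⟨_, h⟩ => nomatch h⟩
  | top i => simp [lowerMap]

theorem upperMap_eq_self (d : Diagram n) (x : Stack n) : d.upperMap x = x ↔ ∃ i, x = bot i := by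
  cases x with
  | bot i => simp [upperMap]
  | mid i => exact ⟨fun h => absurd (upper_injective (a₂ := Sum.inl i) h) (d.link_ne _), fun ⟨_, h⟩ => nomatch h⟩
  | top i => exact ⟨fun h => absurd (upper_injective (a₂ := Sum.inr i) h) (d.link_ne _), fun ⟨_, h⟩ => nomatch h⟩

theorem conn_iff (d e : Diagram n) (x y : Stack n) :
    conn d e x y ↔ EqvGen (fun x y => y = d.lowerMap x ∨ y = e.upperMap x) x y := by
  change EqvGen (Joined d e) x y ↔ _
  constructor
  · refine fun h => h.mono ?_
    rintro x y (⟨a, rfl, rfl⟩ | ⟨a, rfl, rfl⟩)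
    · exact .inl (lowerMap_lower d a).symm
    · exact .inr (upperMap_upper e a).symm
  · have key : ∀ x y, (y = d.lowerMap x ∨ y = e.upperMap x) → EqvGen (Joined d e) x y := by
      rintro x y (rfl | rfl) <;> cases x with
      | bot i => first | exact .refl _ | exact .rel _ _ (.inl ⟨Sum.inl i, rfl, rfl⟩)
      | mid i => first | exact .rel _ _ (.inl ⟨Sum.inr i, rfl, rfl⟩) | exact .rel _ _ (.inr ⟨Sum.inl i, rfl, rfl⟩)
      | top i => first | exact .refl _ | exact .rel _ _ (.inr ⟨Sum.inr i, rfl, rfl⟩)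
    intro h
    induction h with
    | rel x y h => exact key x y h
    | refl x => exact .refl x
    | symm x y _ ih => exact ih.symm
    | trans x y z _ _ h1 h2 => exact h1.trans _ _ _ h2

theorem exists_partner (d e : Diagram n) (a : Point n) :
    ∃ b, b ≠ a ∧ conn d e (outer a) (outer b) ∧
      ∀ c, c ≠ a → conn d e (outer a) (outer c) → c = b := by
  let σ : Equiv.Perm (Stack n) := ⟨d.lowerMap, d.lowerMap, d.lowerMap_lowerMap, d.lowerMap_lowerMap⟩
  let τ : Equiv.Perm (Stack n) := ⟨e.upperMap, e.upperMap, e.upperMap_upperMap, e.upperMap_upperMap⟩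
  have out : ∀ x, (d.lowerMap x = x ∨ e.upperMap x = x) ↔ ∃ b, x = outer b := by
    intro x
    rw [lowerMap_eq_self, upperMap_eq_self]
    constructor
    · rintro (⟨i, rfl⟩ | ⟨i, rfl⟩)
      exacts [⟨.inr i, rfl⟩, ⟨.inl i, rfl⟩]
    · rintro ⟨i | i, rfl⟩
      exacts [.inr ⟨i, rfl⟩, .inl ⟨i, rfl⟩]
  have fin : ∀ r : Stack n → Stack n → Prop, (∀ x y, r x y ↔ conn d e x y) →
      (∃ q, q ≠ outer a ∧ r (outer a) q ∧ (∃ b, q = outer b) ∧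
        ∀ c, c ≠ outer a → r (outer a) c → (∃ b, c = outer b) → c = q) →
      ∃ b, b ≠ a ∧ conn d e (outer a) (outer b) ∧
      ∀ c, c ≠ a → conn d e (outer a) (outer c) → c = b := by
    rintro r hr ⟨_, h1, h2, ⟨b, rfl⟩, h4⟩
    refine ⟨b, fun h => h1 (h ▸ rfl), (hr _ _).1 h2, fun c hc h => outer_injective ?_⟩
    exact h4 _ (fun h => hc (outer_injective h)) ((hr _ _).2 h) ⟨c, rfl⟩
  rcases a with i | i
  · obtain ⟨q, h1, h2, h3, h4⟩ := dihedral σ τ d.lowerMap_lowerMap e.upperMap_upperMap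
      (fun x ⟨h1, h2⟩ => by
        obtain ⟨_, rfl⟩ := (lowerMap_eq_self d x).1 h1
        obtain ⟨_, h⟩ := (upperMap_eq_self e (top _)).1 h2
        cases h) (outer (Sum.inl i)) rfl
    refine fin _ (fun x y => (conn_iff d e x y).symm) ⟨q, h1, h2, (out _).1 h3, fun c h5 h6 h7 => ?_⟩
    exact h4 c h5 h6 ((out c).2 h7)
  · obtain ⟨q, h1, h2, h3, h4⟩ := dihedral τ σ e.upperMap_upperMap d.lowerMap_lowerMap
      (fun x ⟨h2, h1⟩ => by
        obtain ⟨_, rfl⟩ := (lowerMap_eq_self d x).1 h1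
        obtain ⟨_, h⟩ := (upperMap_eq_self e (top _)).1 h2
        cases h) (outer (Sum.inr i)) rfl
    refine fin (EqvGen (fun x y => y = e.upperMap x ∨ y = d.lowerMap x))
      (fun x y => ?_) ⟨q, h1, h2, (out _).1 h3.symm, fun c h5 h6 h7 => ?_⟩
    · rw [conn_iff]
      simp only [or_comm]
    · exact h4 c h5 h6 ((out c).2 h7).symm

/-- The point of the compressed rectangle connected to the point `a`. -/
noncomputable def compLink (d e : Diagram n) (a : Point n) : Point n := (exists_partner d e a).choose

theorem compLink_ne (d e : Diagram n) (a : Point n) : compLink d e a ≠ a :=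
  (exists_partner d e a).choose_spec.1

theorem conn_compLink (d e : Diagram n) (a : Point n) :
    conn d e (outer a) (outer (compLink d e a)) :=
  (exists_partner d e a).choose_spec.2.1

theorem eq_compLink (d e : Diagram n) (a c : Point n) (hc : c ≠ a)
    (h : conn d e (outer a) (outer c)) : c = compLink d e a :=
  (exists_partner d e a).choose_spec.2.2 c hc h

theorem sum_half (d : Diagram n) (f : Point n → ZMod 2) :
    ∑ a, f a = ∑ a with pos a < pos (d.link a), (f a + f (d.link a)) := by
  have posinj : ∀ a b : Point n, pos a = pos b → a = b := by
    rintro (a | a) (b | b) h <;> simp only [pos] at h <;>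
      first | (congr 1; apply Fin.ext; omega) | (exfalso; omega)
  rw [Finset.sum_add_distrib, ← Finset.sum_filter_add_sum_filter_not Finset.univ
    (fun a => pos a < pos (d.link a)) f]
  congr 1
  refine Finset.sum_bij' (fun a _ => d.link a) (fun a _ => d.link a) ?_ ?_ ?_ ?_ ?_
  · intro a ha
    simp only [Finset.mem_filter, Finset.mem_univ, true_and, d.link_link] at ha ⊢
    exact lt_of_le_of_ne (not_lt.1 ha) fun h => d.link_ne a (posinj _ _ h)
  · intro a ha
    simp only [Finset.mem_filter, Finset.mem_univ, true_and, d.link_link] at ha ⊢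
    exact not_lt.2 ha.le
  · intro a _; exact d.link_link a
  · intro a _; exact d.link_link a
  · intro a _; simp [d.link_link]

theorem sum_invariant (d : Diagram n) (f : Point n → ZMod 2) (hf : ∀ a, f (d.link a) = f a) :
    ∑ a, f a = 0 := by
  rw [sum_half d]
  exact Finset.sum_eq_zero fun a _ => by rw [hf]; exact CharTwo.add_self_eq_zero _

theorem sum_cross (d : Diagram n) (f g : Point n → ZMod 2) (hf : ∀ a, f (d.link a) = f a)
    (hg : ∀ a, g (d.link a) = g a) (hfg : ∀ a, f a * g a = 0) :
    ∑ a, ∑ b, f a * g b * (if pos a < pos b then 1 else 0) = 0 := by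
  rw [sum_half d]
  refine Finset.sum_eq_zero fun a ha => ?_
  rw [← Finset.sum_add_distrib, sum_half d]
  refine Finset.sum_eq_zero fun b hb => ?_
  simp only [Finset.mem_filter, Finset.mem_univ, true_and] at ha hb
  simp only [hf, hg]
  have h1 := d.noncrossing a b
  have h2 := d.noncrossing b a
  have posinj : ∀ a b : Point n, pos a = pos b → a = b := by
    rintro (a | a) (b | b) h <;> simp only [pos] at h <;>
      first | (congr 1; apply Fin.ext; omega) | (exfalso; omega)
  by_cases hab : b = a ∨ b = d.link a
  · have : f a * g b = 0 := by
      rcases hab with rfl | rfl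
      · exact hfg _
      · rw [hg]; exact hfg _
    simp [this]
  · push Not at hab
    have n1 : pos a ≠ pos b := fun h => hab.1 (posinj _ _ h).symm
    have n2 : pos (d.link a) ≠ pos b := fun h => hab.2 (posinj _ _ h).symm
    have n3 : pos a ≠ pos (d.link b) := fun h => hab.2 (by rw [posinj _ _ h, d.link_link])
    have n4 : pos (d.link a) ≠ pos (d.link b) := fun h => hab.1 (by
      have := congrArg d.link (posinj _ _ h); rw [d.link_link, d.link_link] at this; exact this.symm)
    have t : (1 + 1 : ZMod 2) = 0 := rfl
    rw [← mul_add, ← mul_add, ← mul_add]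
    convert mul_zero (f a * g b)
    generalize pos a = x at *
    generalize pos b = y at *
    generalize pos (d.link a) = z at *
    generalize pos (d.link b) = w at *
    split_ifs <;> first | rfl | (exfalso; omega)

theorem comp_noncrossing (d e : Diagram n) (a b : Point n) :
    ¬ (pos a < pos b ∧ pos b < pos (compLink d e a) ∧ pos (compLink d e a) < pos (compLink d e b)) := by
  classical
  rintro ⟨h1, h2, h3⟩
  set a' := compLink d e a with ha'
  set b' := compLink d e b with hb'
  have hca := conn_compLink d e a
  have hcb := conn_compLink d e b
  rw [← ha'] at hca
  rw [← hb'] at hcb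
  have hab : ¬ conn d e (outer a) (outer b) := by
    intro h
    have := eq_compLink d e a b (by rintro rfl; omega) h
    rw [this, ← ha'] at h2; omega
  let P : Stack n → ZMod 2 := fun x => if conn d e (outer a) x then 1 else 0
  let R : Stack n → ZMod 2 := fun x => if conn d e (outer b) x then 1 else 0
  have hinv : ∀ c x y, conn d e x y → 
      (if conn d e c x then (1 : ZMod 2) else 0) = if conn d e c y then 1 else 0 := by
    intro c x y h
    have : conn d e c x ↔ conn d e c y :=
      ⟨fun h' => (conn d e).trans h' h, fun h' => (conn d e).trans h' ((conn d e).symm h)⟩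
    simp only [this]
  have jl : ∀ c, conn d e (lower (d.link c)) (lower c) := fun c =>
    (conn d e).symm (.rel _ _ (.inl ⟨c, rfl, rfl⟩))
  have ju : ∀ c, conn d e (upper (e.link c)) (upper c) := fun c =>
    (conn d e).symm (.rel _ _ (.inr ⟨c, rfl, rfl⟩))
  have hPR : ∀ x, P x * R x = 0 := by
    intro x
    simp only [P, R]
    split_ifs with h1 h2
    · exact absurd ((conn d e).trans h1 ((conn d e).symm h2)) hab
    all_goals rfl
  have c1 := sum_cross d (fun c => P (lower c)) (fun c => R (lower c))
    (fun c => hinv _ _ _ (jl c)) (fun c => hinv _ _ _ (jl c)) (fun c => hPR _)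
  have c2 := sum_cross e (fun c => P (upper c)) (fun c => R (upper c))
    (fun c => hinv _ _ _ (ju c)) (fun c => hinv _ _ _ (ju c)) (fun c => hPR _)
  have c3 := sum_invariant d (fun c => P (lower c)) (fun c => hinv _ _ _ (jl c))
  have c4 := sum_invariant e (fun c => R (upper c)) (fun c => hinv _ _ _ (ju c))
  have expand : ∀ f g : Point n → ZMod 2,
      ∑ a, ∑ b, f a * g b * (if pos a < pos b then 1 else 0) =
        (∑ i : Fin n, ∑ j : Fin n, f (.inl i) * g (.inl j) * (if i < j then 1 else 0)) +
        (∑ i : Fin n, f (.inl i)) * (∑ j : Fin n, g (.inr j)) +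
        (∑ i : Fin n, ∑ j : Fin n, f (.inr i) * g (.inr j) * (if j < i then 1 else 0)) := by
    intro f g
    simp only [Fintype.sum_sum_type, Finset.sum_add_distrib, Finset.sum_mul_sum]
    have q1 : ∀ i j : Fin n, (pos (.inl i : Point n) < pos (.inl j : Point n)) ↔ i < j := by
      intro i j; simp [pos]
    have q2 : ∀ i j : Fin n, (pos (.inl i : Point n) < pos (.inr j : Point n)) := by
      intro i j; simp only [pos]; omega
    have q3 : ∀ i j : Fin n, ¬ (pos (.inr i : Point n) < pos (.inl j : Point n)) := by
      intro i j; simp only [pos]; omega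
    have q4 : ∀ i j : Fin n, (pos (.inr i : Point n) < pos (.inr j : Point n)) ↔ j < i := by
      intro i j; simp only [pos, Fin.lt_def]; omega
    simp only [q1, q2, q3, q4, if_true, if_false, mul_one, mul_zero, Finset.sum_const_zero]
    ring
  have c5 : ∑ x, ∑ y, P (outer x) * R (outer y) * (if pos x < pos y then 1 else 0) = 0 := by
    rw [expand] at c1 c2 ⊢
    rw [Fintype.sum_sum_type] at c3 c4
    simp only [lower, upper, outer] at *
    have c6 : (∑ i : Fin n, ∑ j : Fin n, P (mid i) * R (mid j) * (if i < j then 1 else 0)) +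
        (∑ i : Fin n, ∑ j : Fin n, P (mid i) * R (mid j) * (if j < i then 1 else 0)) =
        (∑ i : Fin n, P (mid i)) * (∑ j : Fin n, R (mid j)) := by
      rw [Finset.sum_mul_sum, ← Finset.sum_add_distrib]
      refine Finset.sum_congr rfl fun i _ => ?_
      rw [← Finset.sum_add_distrib]
      refine Finset.sum_congr rfl fun j _ => ?_
      rcases lt_trichotomy i j with h | rfl | h
      · simp [h, not_lt.2 h.le]
      · simp [hPR]
      · simp [h, not_lt.2 h.le]
    have two : (2 : ZMod 2) = 0 := rfl
    have b1 : ∑ i : Fin n, P (bot i) = ∑ i : Fin n, P (mid i) := by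
      linear_combination c3 - (∑ i : Fin n, P (mid i)) * two
    have b2 : ∑ i : Fin n, R (top i) = ∑ i : Fin n, R (mid i) := by
      linear_combination c4 - (∑ i : Fin n, R (mid i)) * two
    rw [b1] at c1 ⊢
    rw [b2] at c2 ⊢
    linear_combination c1 + c2 - c6 - (∑ i : Fin n, P (mid i)) * (∑ i : Fin n, R (mid i)) * two
  have hP : ∀ x, P (outer x) = if x = a ∨ x = a' then 1 else 0 := by
    intro x
    simp only [P]
    congr 1
    refine propext ⟨fun h => ?_, ?_⟩
    · by_cases hx : x = a
      · exact .inl hx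
      · exact .inr (eq_compLink d e a x hx h)
    · rintro (rfl | rfl)
      exacts [(conn d e).refl _, hca]
  have hR : ∀ x, R (outer x) = if x = b ∨ x = b' then 1 else 0 := by
    intro x
    simp only [R]
    congr 1
    refine propext ⟨fun h => ?_, ?_⟩
    · by_cases hx : x = b
      · exact .inl hx
      · exact .inr (eq_compLink d e b x hx h)
    · rintro (rfl | rfl)
      exacts [(conn d e).refl _, hcb]
  have spl : ∀ (u v : Point n) (huv : u ≠ v) (f : Point n → ZMod 2),
      ∑ x, (if x = u ∨ x = v then 1 else 0) * f x = f u + f v := by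
    intro u v huv f
    have : ∀ x, (if x = u ∨ x = v then (1 : ZMod 2) else 0) * f x =
        (if x = u then f x else 0) + (if x = v then f x else 0) := by
      intro x
      by_cases h1 : x = u
      · subst h1; simp [huv]
      · simp [h1]
    simp only [this, Finset.sum_add_distrib, Finset.sum_ite_eq', Finset.mem_univ, if_true]
  have e1 : a ≠ a' := (compLink_ne d e a).symm
  have e2 : b ≠ b' := (compLink_ne d e b).symm
  simp only [hP, hR, mul_assoc, ← Finset.mul_sum, spl b b' e2] at c5
  rw [spl a a' e1] at c5
  rw [if_pos h1, if_pos (by omega), if_neg (by omega), if_pos h3] at c5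
  exact absurd c5 (by decide)

/-- The diagram obtained by placing `e` on top of `d`, compressing, and deleting the bubbles. -/
noncomputable def comp (d e : Diagram n) : Diagram n where
  link := compLink d e
  link_link a := (eq_compLink d e _ _ (compLink_ne d e a).symm
    ((conn d e).symm (conn_compLink d e a))).symm
  link_ne := compLink_ne d e
  noncrossing := comp_noncrossing d e

theorem conn_outer_iff (d e : Diagram n) (a b : Point n) :
    conn d e (outer a) (outer b) ↔ b = a ∨ b = (comp d e).link a := by
  constructor
  · intro h
    by_cases hb : b = a
    · exact .inl hb
    · exact .inr (eq_compLink d e a b hb h)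
  · rintro (rfl | rfl)
    exacts [(conn d e).refl _, conn_compLink d e a]

end Diagram
end TemperleyLieb

namespace TemperleyLieb
open Relation

section Glue

variable {X Y Z : Type*}

theorem eqvGen_map {h : Z → X} (hh : Function.Injective h) {s : Z → Z → Prop} {u v : X}
    (huv : EqvGen (Relation.Map s h h) u v) :
    u = v ∨ ∃ z z', u = h z ∧ v = h z' ∧ EqvGen s z z' := by
  induction huv with
  | rel x y hxy =>
    obtain ⟨z, z', hs, rfl, rfl⟩ := hxy
    exact .inr ⟨z, z', rfl, rfl, .rel _ _ hs⟩
  | refl x => exact .inl rfl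
  | symm x y _ ih =>
    rcases ih with rfl | ⟨z, z', rfl, rfl, h1⟩
    exacts [.inl rfl, .inr ⟨z', z, rfl, rfl, h1.symm⟩]
  | trans x y w _ _ h1 h2 =>
    rcases h1 with rfl | ⟨z, z', rfl, rfl, h1⟩
    · exact h2
    · rcases h2 with rfl | ⟨t, t', h3, rfl, h2⟩
      · exact .inr ⟨z, z', rfl, rfl, h1⟩
      · obtain rfl := hh h3
        exact .inr ⟨z, t', rfl, rfl, h1.trans _ _ _ h2⟩

theorem eqvGen_transfer {r : X → X → Prop} {P : X → Prop}
    (hP : ∀ u v, r u v → (P u ↔ P v)) {u v : X} (h : EqvGen r u v) : P u ↔ P v := by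
  induction h with
  | rel x y h => exact hP x y h
  | refl x => rfl
  | symm x y _ ih => exact ih.symm
  | trans x y z _ _ h1 h2 => exact h1.trans h2

theorem eqvGen_glue {r1 r2 : X → X → Prop} {s : Y → Y → Prop} {g : Y → X}
    (h1 : ∀ x y, EqvGen r1 (g x) (g y) → EqvGen s x y)
    (h2 : ∀ u v, r2 u v → ∃ x y, u = g x ∧ v = g y ∧ s x y)
    (h3 : ∀ x y, s x y → EqvGen (fun u v => r1 u v ∨ r2 u v) (g x) (g y)) (x y : Y) :
    EqvGen (fun u v => r1 u v ∨ r2 u v) (g x) (g y) ↔ EqvGen s x y := by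
  constructor
  · intro h
    have key := eqvGen_transfer (P := fun v => ∃ w, EqvGen s x w ∧ EqvGen r1 (g w) v) ?_ h
    · obtain ⟨w, hw1, hw2⟩ := key.1 ⟨x, .refl _, .refl _⟩
      exact hw1.trans _ _ _ (h1 _ _ hw2)
    · rintro u v (huv | huv)
      · constructor
        · rintro ⟨w, a, b⟩; exact ⟨w, a, b.trans _ _ _ (.rel _ _ huv)⟩
        · rintro ⟨w, a, b⟩; exact ⟨w, a, b.trans _ _ _ (.symm _ _ (.rel _ _ huv))⟩
      · obtain ⟨p, q, rfl, rfl, hs⟩ := h2 _ _ huv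
        constructor
        · rintro ⟨w, a, b⟩
          exact ⟨q, (a.trans _ _ _ (h1 _ _ b)).trans _ _ _ (.rel _ _ hs), .refl _⟩
        · rintro ⟨w, a, b⟩
          exact ⟨p, (a.trans _ _ _ (h1 _ _ b)).trans _ _ _ (.symm _ _ (.rel _ _ hs)), .refl _⟩
  · intro h
    induction h with
    | rel x y h => exact h3 x y h
    | refl x => exact .refl _
    | symm x y _ ih => exact ih.symm
    | trans x y z _ _ h1 h2 => exact h1.trans _ _ _ h2

theorem ncard_glue [Finite X] {T : Setoid X} {S : Setoid Y} {U : Setoid Z} {g : Y → X} {h : Z → X}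
    {I : X → Prop} (hh : Function.Injective h) (ha : ∀ x y, T (g x) (g y) ↔ S x y)
    (hb : ∀ z v, (∀ z', U z z' → h z' ∉ Set.range g) → T (h z) v → ∃ z', v = h z' ∧ U z z')
    (hc : ∀ v, v ∈ Set.range g ∨ v ∈ Set.range h) (hd : ∀ z, h z ∉ Set.range g → I (h z))
    (he : ∀ z z', U z z' → T (h z) (h z')) :
    Set.ncard {c : Quotient T | ∀ x, Quotient.mk T x = c → I x} =
      Set.ncard {c : Quotient S | ∀ y, Quotient.mk S y = c → I (g y)} +
      Set.ncard {c : Quotient U | ∀ z, Quotient.mk U z = c → h z ∉ Set.range g} := by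
  let φ : Quotient S → Quotient T := Quotient.map g fun x y hxy => (ha x y).2 hxy
  let ψ : Quotient U → Quotient T := Quotient.map h he
  have hφ : Function.Injective φ := by
    intro a b hab
    induction a using Quotient.ind
    induction b using Quotient.ind
    exact Quotient.sound ((ha _ _).1 (Quotient.exact hab))
  have hUset : ∀ z, Quotient.mk U z ∈ {c : Quotient U | ∀ z, Quotient.mk U z = c → h z ∉ Set.range g}
      ↔ ∀ z', U z z' → h z' ∉ Set.range g := by
    intro z
    exact ⟨fun H z' hz => H z' (Quotient.sound (U.symm hz)),
      fun H z' hz => H z' (U.symm (Quotient.exact hz))⟩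
  have hψ : Set.InjOn ψ {c : Quotient U | ∀ z, Quotient.mk U z = c → h z ∉ Set.range g} := by
    intro a hA b _ hab
    induction a using Quotient.ind with | _ z
    induction b using Quotient.ind with | _ w
    obtain ⟨z', h1, h2⟩ := hb z (h w) ((hUset z).1 hA) (Quotient.exact hab)
    rw [hh h1]
    exact Quotient.sound h2
  have hcover : {c : Quotient T | ∀ x, Quotient.mk T x = c → I x} =
      φ '' {c : Quotient S | ∀ y, Quotient.mk S y = c → I (g y)} ∪
      ψ '' {c : Quotient U | ∀ z, Quotient.mk U z = c → h z ∉ Set.range g} := by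
    ext c
    constructor
    · intro hcI
      by_cases hg : ∃ y, Quotient.mk T (g y) = c
      · obtain ⟨y, rfl⟩ := hg
        refine .inl ⟨Quotient.mk S y, fun y' hy' => hcI _ ?_, rfl⟩
        exact Quotient.sound ((ha _ _).2 (Quotient.exact hy'))
      · push Not at hg
        induction c using Quotient.ind with | _ x
        rcases hc x with ⟨y, rfl⟩ | ⟨z, rfl⟩
        · exact absurd rfl (hg y)
        · refine .inr ⟨Quotient.mk U z, (hUset z).2 fun z' hz' => ?_, rfl⟩
          rintro ⟨y, hy⟩
          exact hg y (Quotient.sound (hy ▸ T.symm (he _ _ hz')))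
    · rintro (⟨s, hs, rfl⟩ | ⟨u, hu, rfl⟩)
      · induction s using Quotient.ind with | _ y
        intro x hx
        by_cases hxg : x ∈ Set.range g
        · obtain ⟨y', rfl⟩ := hxg
          exact hs y' (Quotient.sound ((ha _ _).1 (Quotient.exact hx)))
        · rcases hc x with hx' | ⟨z, rfl⟩
          · exact absurd hx' hxg
          · exact hd z hxg
      · induction u using Quotient.ind with | _ z
        intro x hx
        have hz := (hUset z).1 hu
        obtain ⟨z', rfl, h2⟩ := hb z x hz (T.symm (Quotient.exact hx))
        exact hd z' (hz z' h2)
  have hdisj : Disjoint (φ '' {c : Quotient S | ∀ y, Quotient.mk S y = c → I (g y)})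
      (ψ '' {c : Quotient U | ∀ z, Quotient.mk U z = c → h z ∉ Set.range g}) := by
    rw [Set.disjoint_left]
    rintro _ ⟨s, _, rfl⟩ ⟨u, hu, hsu⟩
    induction s using Quotient.ind with | _ y
    induction u using Quotient.ind with | _ z
    have hz := (hUset z).1 hu
    obtain ⟨z', h1, h2⟩ := hb z (g y) hz (Quotient.exact hsu)
    exact hz z' h2 ⟨y, h1⟩
  have : Finite (Quotient T) := Quotient.finite _
  rw [hcover, Set.ncard_union_eq hdisj (Set.toFinite _) (Set.toFinite _),
    Set.ncard_image_of_injective _ hφ, hψ.ncard_image]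

end Glue

open Stack

namespace Diagram
variable {n : ℕ}

/-- The stack of two rectangles, placed on the sides `k`, `l`, `m` of a stack of three rectangles. -/
def row (k l m : Fin 4) : Stack n → Fin 4 × Fin n
  | bot i => (k, i)
  | mid i => (l, i)
  | top i => (m, i)

/-- A rectangle placed between the sides `k` and `l` of a stack of three rectangles. -/
def place (k l : Fin 4) : Point n → Fin 4 × Fin n
  | Sum.inl i => (k, i)
  | Sum.inr i => (l, i)

/-- The links of the diagram `d` placed between the sides `k` and `l`. -/
def PlacedLink (k l : Fin 4) (d : Diagram n) (u v : Fin 4 × Fin n) : Prop :=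
  ∃ a, u = place k l a ∧ v = place k l (d.link a)

theorem row_lower (k l m : Fin 4) (a : Point n) : row k l m (lower a) = place k l a := by
  rcases a with a | a <;> rfl
theorem row_upper (k l m : Fin 4) (a : Point n) : row k l m (upper a) = place l m a := by
  rcases a with a | a <;> rfl
theorem row_outer (k l m : Fin 4) (a : Point n) : row k l m (outer a) = place k m a := by
  rcases a with a | a <;> rfl

theorem row_injective {k l m : Fin 4} (h1 : k ≠ l) (h2 : l ≠ m) (h3 : k ≠ m) :
    Function.Injective (row (n := n) k l m) := by
  intro x y h
  cases x <;> cases y <;> simp_all [row, eq_comm]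

theorem map_joined (k l m : Fin 4) (d e : Diagram n) :
    Relation.Map (Joined d e) (row k l m) (row k l m) =
      fun u v => PlacedLink k l d u v ∨ PlacedLink l m e u v := by
  ext u v
  constructor
  · rintro ⟨x, y, ⟨a, rfl, rfl⟩ | ⟨a, rfl, rfl⟩, rfl, rfl⟩
    · exact .inl ⟨a, row_lower .., row_lower ..⟩
    · exact .inr ⟨a, row_upper .., row_upper ..⟩
  · rintro (⟨a, rfl, rfl⟩ | ⟨a, rfl, rfl⟩)
    · exact ⟨_, _, .inl ⟨a, rfl, rfl⟩, row_lower .., row_lower ..⟩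
    · exact ⟨_, _, .inr ⟨a, rfl, rfl⟩, row_upper .., row_upper ..⟩

/-- Connectedness in the stack of three rectangles. -/
def conn₃ (d e f : Diagram n) : Setoid (Fin 4 × Fin n) :=
  Relation.EqvGen.setoid fun u v => PlacedLink 0 1 d u v ∨ PlacedLink 1 2 e u v ∨ PlacedLink 2 3 f u v

theorem conn₃_left (d e f : Diagram n) (u v : Fin 4 × Fin n) : conn₃ d e f u v ↔
    EqvGen (fun u v => Relation.Map (Joined d e) (row 0 1 2) (row 0 1 2) u v ∨ PlacedLink 2 3 f u v) u v := by
  simp only [map_joined, or_assoc]; rfl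

theorem conn₃_right (d e f : Diagram n) (u v : Fin 4 × Fin n) : conn₃ d e f u v ↔
    EqvGen (fun u v => Relation.Map (Joined e f) (row 1 2 3) (row 1 2 3) u v ∨ PlacedLink 0 1 d u v) u v := by
  simp only [map_joined, or_comm (b := PlacedLink 0 1 d _ _)]; rfl

theorem conn_place {k l m : Fin 4} (d e : Diagram n) (x y : Stack n) (h : conn d e x y) :
    EqvGen (Relation.Map (Joined d e) (row k l m) (row k l m)) (row k l m x) (row k l m y) := by
  change EqvGen (Joined d e) x y at h
  induction h with
  | rel x y h => exact .rel _ _ ⟨x, y, h, rfl, rfl⟩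
  | refl x => exact .refl _
  | symm x y _ ih => exact ih.symm
  | trans x y z _ _ h1 h2 => exact h1.trans _ _ _ h2

theorem conn₃_comp_left (d e f : Diagram n) (x y : Stack n) :
    conn₃ d e f (row 0 2 3 x) (row 0 2 3 y) ↔ conn (comp d e) f x y := by
  rw [conn₃_left]
  refine eqvGen_glue ?_ ?_ ?_ x y
  · intro x y h
    rcases eqvGen_map (row_injective (by decide) (by decide) (by decide)) h with h | ⟨z, z', h1, h2, h3⟩
    · rw [row_injective (by decide) (by decide) (by decide) h]; exact .refl _
    · have out : ∀ (x z : Stack n), row 0 2 3 x = row 0 1 2 z → ∃ a, x = lower a ∧ z = outer a := by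
        intro x z h
        cases x <;> cases z <;> simp_all [row]
        · exact .inl ⟨_, rfl, rfl⟩
        · exact .inr ⟨_, rfl, rfl⟩
      obtain ⟨a, rfl, rfl⟩ := out x z h1
      obtain ⟨b, rfl, rfl⟩ := out y z' h2
      rcases (conn_outer_iff d e a b).1 h3 with rfl | rfl
      · exact .refl _
      · exact .rel _ _ (.inl ⟨a, rfl, rfl⟩)
  · rintro u v ⟨a, rfl, rfl⟩
    exact ⟨upper a, upper (f.link a), (row_upper ..).symm, (row_upper ..).symm, .inr ⟨a, rfl, rfl⟩⟩
  · rintro x y (⟨a, rfl, rfl⟩ | ⟨a, rfl, rfl⟩)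
    · have := conn_place (k := 0) (l := 1) (m := 2) d e _ _ ((conn_outer_iff d e a _).2 (.inr rfl))
      rw [row_outer, row_outer] at this
      rw [row_lower, row_lower]
      exact this.mono fun _ _ h => .inl h
    · rw [row_upper, row_upper]
      exact .rel _ _ (.inr ⟨a, rfl, rfl⟩)

theorem conn₃_comp_right (d e f : Diagram n) (x y : Stack n) :
    conn₃ d e f (row 0 1 3 x) (row 0 1 3 y) ↔ conn d (comp e f) x y := by
  rw [conn₃_right]
  refine eqvGen_glue ?_ ?_ ?_ x y
  · intro x y h
    rcases eqvGen_map (row_injective (by decide) (by decide) (by decide)) h with h | ⟨z, z', h1, h2, h3⟩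
    · rw [row_injective (by decide) (by decide) (by decide) h]; exact .refl _
    · have out : ∀ (x z : Stack n), row 0 1 3 x = row 1 2 3 z → ∃ a, x = upper a ∧ z = outer a := by
        intro x z h
        cases x <;> cases z <;> simp_all [row]
        · exact .inl ⟨_, rfl, rfl⟩
        · exact .inr ⟨_, rfl, rfl⟩
      obtain ⟨a, rfl, rfl⟩ := out x z h1
      obtain ⟨b, rfl, rfl⟩ := out y z' h2
      rcases (conn_outer_iff e f a b).1 h3 with rfl | rfl
      · exact .refl _
      · exact .rel _ _ (.inr ⟨a, rfl, rfl⟩)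
  · rintro u v ⟨a, rfl, rfl⟩
    exact ⟨lower a, lower (d.link a), (row_lower ..).symm, (row_lower ..).symm, .inl ⟨a, rfl, rfl⟩⟩
  · rintro x y (⟨a, rfl, rfl⟩ | ⟨a, rfl, rfl⟩)
    · rw [row_lower, row_lower]
      exact .rel _ _ (.inr ⟨a, rfl, rfl⟩)
    · have := conn_place (k := 1) (l := 2) (m := 3) e f _ _ ((conn_outer_iff e f a _).2 (.inr rfl))
      rw [row_outer, row_outer] at this
      rw [row_upper, row_upper]
      exact this.mono fun _ _ h => .inl h

theorem comp_assoc (d e f : Diagram n) : comp (comp d e) f = comp d (comp e f) := by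
  ext1
  funext a
  refine eq_compLink d (comp e f) a _ ((comp (comp d e) f).link_ne a) ?_
  rw [← conn₃_comp_right, row_outer, row_outer]
  have := (conn_outer_iff (comp d e) f a _).2 (.inr rfl)
  rw [← conn₃_comp_left, row_outer, row_outer] at this
  exact this

theorem class_of {r1 r2 : Fin 4 × Fin n → Fin 4 × Fin n → Prop} {U : Setoid (Stack n)}
    {g h : Stack n → Fin 4 × Fin n} {T : Setoid (Fin 4 × Fin n)}
    (hT : ∀ u v, T u v ↔ EqvGen (fun u v => r1 u v ∨ r2 u v) u v)
    (h1 : ∀ z v, EqvGen r1 (h z) v → ∃ z', v = h z' ∧ U z z')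
    (h2 : ∀ u v, r2 u v → u ∈ Set.range g ∧ v ∈ Set.range g)
    (z : Stack n) (v : Fin 4 × Fin n) (hz : ∀ z', U z z' → h z' ∉ Set.range g) (hv : T (h z) v) :
    ∃ z', v = h z' ∧ U z z' := by
  refine (eqvGen_transfer (P := fun v => ∃ z', v = h z' ∧ U z z') ?_ ((hT _ _).1 hv)).1
    ⟨z, rfl, U.refl z⟩
  rintro u v (huv | huv)
  · constructor
    · rintro ⟨z', rfl, hU⟩
      obtain ⟨w, rfl, hw⟩ := h1 z' v (.rel _ _ huv)
      exact ⟨w, rfl, U.trans hU hw⟩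
    · rintro ⟨z', rfl, hU⟩
      obtain ⟨w, rfl, hw⟩ := h1 z' u (.symm _ _ (.rel _ _ huv))
      exact ⟨w, rfl, U.trans hU hw⟩
  · constructor
    · rintro ⟨z', rfl, hU⟩
      exact absurd (h2 _ _ huv).1 (hz z' hU)
    · rintro ⟨z', rfl, hU⟩
      exact absurd (h2 _ _ huv).2 (hz z' hU)

theorem map_conn {k l m : Fin 4} (h1 : k ≠ l) (h2 : l ≠ m) (h3 : k ≠ m) (d e : Diagram n)
    (z : Stack n) (v : Fin 4 × Fin n)
    (h : EqvGen (Relation.Map (Joined d e) (row k l m) (row k l m)) (row k l m z) v) :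
    ∃ z', v = row k l m z' ∧ conn d e z z' := by
  rcases eqvGen_map (row_injective h1 h2 h3) h with rfl | ⟨w, w', h4, rfl, h5⟩
  · exact ⟨z, rfl, (conn d e).refl z⟩
  · rw [row_injective h1 h2 h3 h4]
    exact ⟨w', rfl, h5⟩

theorem mem_range_row (k l m : Fin 4) (v : Fin 4 × Fin n) :
    v ∈ Set.range (row (n := n) k l m) ↔ (v.1 = k ∨ v.1 = l ∨ v.1 = m) := by
  obtain ⟨t, i⟩ := v
  constructor
  · rintro ⟨x, hx⟩
    cases x <;> simp_all [row]
  · rintro (h | h | h) <;> simp only at h <;> subst h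
    exacts [⟨bot i, rfl⟩, ⟨mid i, rfl⟩, ⟨top i, rfl⟩]

theorem row_mid_iff (y : Stack n) :
    (((row 0 2 3 y).1 = 1 ∨ (row 0 2 3 y).1 = 2) ↔ ∃ i, y = mid i) ∧
    (((row 0 1 3 y).1 = 1 ∨ (row 0 1 3 y).1 = 2) ↔ ∃ i, y = mid i) ∧
    (row 0 1 2 y ∉ Set.range (row (n := n) 0 2 3) ↔ ∃ i, y = mid i) ∧
    (row 1 2 3 y ∉ Set.range (row (n := n) 0 1 3) ↔ ∃ i, y = mid i) := by
  simp only [mem_range_row]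
  cases y <;> simp [row]

theorem ncard_left (d e f : Diagram n) :
    Set.ncard {c : Quotient (conn₃ d e f) | ∀ x, Quotient.mk (conn₃ d e f) x = c → x.1 = 1 ∨ x.1 = 2} =
      bubbles (comp d e) f + bubbles d e := by
  have A := ncard_glue (T := conn₃ d e f) (S := conn (comp d e) f) (U := conn d e)
    (g := row 0 2 3) (h := row 0 1 2) (I := fun x => x.1 = 1 ∨ x.1 = 2)
    (row_injective (by decide) (by decide) (by decide)) (conn₃_comp_left d e f)
    (class_of (conn₃_left d e f) (map_conn (by decide) (by decide) (by decide) d e)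
      (by rintro u v ⟨a, rfl, rfl⟩; exact ⟨⟨upper _, row_upper ..⟩, ⟨upper _, row_upper ..⟩⟩))
    (fun v => by obtain ⟨k, i⟩ := v; rw [mem_range_row, mem_range_row]; fin_cases k <;> simp)
    (fun z hz => by obtain ⟨i, rfl⟩ := (row_mid_iff z).2.2.1.1 hz; exact .inl rfl)
    (fun z z' h => (conn₃_left ..).2 ((conn_place d e z z' h).mono fun _ _ h => .inl h))
  simp only [(row_mid_iff _).1, (row_mid_iff _).2.2.1] at A
  exact A

theorem ncard_right (d e f : Diagram n) :
    Set.ncard {c : Quotient (conn₃ d e f) | ∀ x, Quotient.mk (conn₃ d e f) x = c → x.1 = 1 ∨ x.1 = 2} =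
      bubbles d (comp e f) + bubbles e f := by
  have A := ncard_glue (T := conn₃ d e f) (S := conn d (comp e f)) (U := conn e f)
    (g := row 0 1 3) (h := row 1 2 3) (I := fun x => x.1 = 1 ∨ x.1 = 2)
    (row_injective (by decide) (by decide) (by decide)) (conn₃_comp_right d e f)
    (class_of (conn₃_right d e f) (map_conn (by decide) (by decide) (by decide) e f)
      (by rintro u v ⟨a, rfl, rfl⟩; exact ⟨⟨lower _, row_lower ..⟩, ⟨lower _, row_lower ..⟩⟩))
    (fun v => by obtain ⟨k, i⟩ := v; rw [mem_range_row, mem_range_row]; fin_cases k <;> simp)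
    (fun z hz => by obtain ⟨i, rfl⟩ := (row_mid_iff z).2.2.2.1 hz; exact .inr rfl)
    (fun z z' h => (conn₃_right ..).2 ((conn_place e f z z' h).mono fun _ _ h => .inl h))
  simp only [(row_mid_iff _).2.1, (row_mid_iff _).2.2.2] at A
  exact A

theorem bubbles_assoc (d e f : Diagram n) :
    bubbles d e + bubbles (comp d e) f = bubbles e f + bubbles d (comp e f) := by
  have h1 := ncard_left d e f
  have h2 := ncard_right d e f
  omega

end Diagram
end TemperleyLieb

namespace TemperleyLieb
open Relation Stack

namespace Diagram
variable {n : ℕ}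

/-- The diagram with straight links only. -/
def straight (n : ℕ) : Diagram n where
  link := Sum.swap
  link_link a := by rcases a with a | a <;> rfl
  link_ne a := by rcases a with a | a <;> simp
  noncrossing a b := by
    rcases a with a | a <;> rcases b with b | b <;> 
      simp only [Sum.swap_inl, Sum.swap_inr, pos] <;> omega

/-- The diagram `E i`: a cup and a cap joining the points of index `i` and `i + 1` (counted from `0`),
and straight links elsewhere. -/
def E (i : Fin (n - 1)) : Diagram n where
  link
    | Sum.inl k =>
      if k.val = i.val then Sum.inl ⟨i.val + 1, by omega⟩
      else if k.val = i.val + 1 then Sum.inl ⟨i.val, by omega⟩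
      else Sum.inr k
    | Sum.inr k =>
      if k.val = i.val then Sum.inr ⟨i.val + 1, by omega⟩
      else if k.val = i.val + 1 then Sum.inr ⟨i.val, by omega⟩
      else Sum.inl k
  link_link a := by
    rcases a with a | a <;> dsimp only <;> split_ifs <;> simp_all [Fin.ext_iff]
  link_ne a := by
    rcases a with a | a <;> dsimp only <;> split_ifs <;> simp_all [Fin.ext_iff]
  noncrossing a b := by
    rcases a with a | a <;> rcases b with b | b <;> dsimp only <;> split_ifs <;>
      simp only [pos] <;> omega

theorem conn_straight_left (e : Diagram n) (x y : Stack n) (h : conn (straight n) e x y) :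
    let p : Stack n → Point n := fun
      | bot i => .inl i
      | mid i => .inl i
      | top i => .inr i
    p y = p x ∨ p y = e.link (p x) := by
  intro p
  have hl : ∀ a, p (lower a) = p (lower ((straight n).link a)) := by rintro (a | a) <;> rfl
  have hu : ∀ a, p (upper a) = a := by rintro (a | a) <;> rfl
  change EqvGen _ _ _ at h
  induction h with
  | rel x y h =>
    rcases h with ⟨a, rfl, rfl⟩ | ⟨a, rfl, rfl⟩
    · exact .inl (hl a).symm
    · exact .inr (by rw [hu, hu])
  | refl x => exact .inl rfl
  | symm x y _ ih =>
    rcases ih with h | h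
    · exact .inl h.symm
    · exact .inr (by rw [h, e.link_link])
  | trans x y z _ _ h1 h2 =>
    rcases h1 with h1 | h1 <;> rcases h2 with h2 | h2
    · exact .inl (h2.trans h1)
    · exact .inr (by rw [h2, h1])
    · exact .inr (by rw [h2, h1])
    · exact .inl (by rw [h2, h1, e.link_link])

theorem conn_straight_right (e : Diagram n) (x y : Stack n) (h : conn e (straight n) x y) :
    let p : Stack n → Point n := fun
      | bot i => .inl i
      | mid i => .inr i
      | top i => .inr i
    p y = p x ∨ p y = e.link (p x) := by
  intro p
  have hl : ∀ a, p (upper a) = p (upper ((straight n).link a)) := by rintro (a | a) <;> rfl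
  have hu : ∀ a, p (lower a) = a := by rintro (a | a) <;> rfl
  change EqvGen _ _ _ at h
  induction h with
  | rel x y h =>
    rcases h with ⟨a, rfl, rfl⟩ | ⟨a, rfl, rfl⟩
    · exact .inr (by rw [hu, hu])
    · exact .inl (hl a).symm
  | refl x => exact .inl rfl
  | symm x y _ ih =>
    rcases ih with h | h
    · exact .inl h.symm
    · exact .inr (by rw [h, e.link_link])
  | trans x y z _ _ h1 h2 =>
    rcases h1 with h1 | h1 <;> rcases h2 with h2 | h2
    · exact .inl (h2.trans h1)
    · exact .inr (by rw [h2, h1])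
    · exact .inr (by rw [h2, h1])
    · exact .inl (by rw [h2, h1, e.link_link])

theorem straight_comp (e : Diagram n) : comp (straight n) e = e := by
  ext1
  funext a
  have h := conn_straight_left e _ _ (conn_compLink (straight n) e a)
  have h2 := compLink_ne (straight n) e a
  change compLink (straight n) e a = _
  rcases a with a | a <;> rcases hb : compLink (straight n) e _ with b | b <;> rw [hb] at h h2 <;>
    exact h.resolve_left h2

theorem comp_straight (e : Diagram n) : comp e (straight n) = e := by
  ext1
  funext a
  have h := conn_straight_right e _ _ (conn_compLink e (straight n) a)
  have h2 := compLink_ne e (straight n) a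
  change compLink e (straight n) a = _
  rcases a with a | a <;> rcases hb : compLink e (straight n) _ with b | b <;> rw [hb] at h h2 <;>
    exact h.resolve_left h2

theorem bubbles_eq_zero (d e : Diagram n) (h : ∀ i, ∃ j, conn d e (mid i) (bot j) ∨ conn d e (mid i) (top j)) :
    bubbles d e = 0 := by
  have : Finite (Quotient (conn d e)) := Quotient.finite _
  unfold bubbles
  rw [Set.ncard_eq_zero (Set.toFinite _)]
  refine Set.eq_empty_of_forall_notMem fun c hc => ?_
  induction c using Quotient.ind with | _ x
  obtain ⟨i, rfl⟩ := hc x rfl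
  obtain ⟨j, hj | hj⟩ := h i
  · obtain ⟨k, hk⟩ := hc (bot j) (Quotient.sound ((conn d e).symm hj)); cases hk
  · obtain ⟨k, hk⟩ := hc (top j) (Quotient.sound ((conn d e).symm hj)); cases hk

theorem bubbles_straight_left (e : Diagram n) : bubbles (straight n) e = 0 :=
  bubbles_eq_zero _ _ fun i => ⟨i, .inl (.rel _ _ (.inl ⟨.inr i, rfl, rfl⟩))⟩

theorem bubbles_straight_right (e : Diagram n) : bubbles e (straight n) = 0 :=
  bubbles_eq_zero _ _ fun i => ⟨i, .inr (.rel _ _ (.inr ⟨.inl i, rfl, rfl⟩))⟩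

end Diagram

/-- The monoid generated by the diagrams and a bubble symbol commuting with all diagrams: the pair
`⟨p, d⟩` is the diagram `d` together with `p` bubbles. -/
@[ext]
structure BubbleDiagram (n : ℕ) where
  bubbles : ℕ
  diagram : Diagram n

namespace BubbleDiagram
variable {n : ℕ}

/-- In a product `x * y`, the rectangle of `y` is placed on top of that of `x`, and the bubbles which
appear are counted. -/
noncomputable instance : Monoid (BubbleDiagram n) where
  mul x y := ⟨x.bubbles + y.bubbles + Diagram.bubbles x.diagram y.diagram,
    Diagram.comp x.diagram y.diagram⟩
  one := ⟨0, Diagram.straight n⟩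
  mul_assoc x y z := by
    refine BubbleDiagram.ext ?_ (Diagram.comp_assoc _ _ _)
    have := Diagram.bubbles_assoc x.diagram y.diagram z.diagram
    change x.bubbles + y.bubbles + Diagram.bubbles x.diagram y.diagram + z.bubbles +
      Diagram.bubbles (Diagram.comp x.diagram y.diagram) z.diagram =
      x.bubbles + (y.bubbles + z.bubbles + Diagram.bubbles y.diagram z.diagram) +
      Diagram.bubbles x.diagram (Diagram.comp y.diagram z.diagram)
    omega
  one_mul x := by
    refine BubbleDiagram.ext ?_ (Diagram.straight_comp _)
    change 0 + x.bubbles + Diagram.bubbles (Diagram.straight n) x.diagram = _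
    rw [Diagram.bubbles_straight_left]; omega
  mul_one x := by
    refine BubbleDiagram.ext ?_ (Diagram.comp_straight _)
    change x.bubbles + 0 + Diagram.bubbles x.diagram (Diagram.straight n) = _
    rw [Diagram.bubbles_straight_right]; omega

/-- A diagram, without bubbles. -/
def of (d : Diagram n) : BubbleDiagram n := ⟨0, d⟩

/-- The bubble symbol `𝒯`. -/
def bubble (n : ℕ) : BubbleDiagram n := ⟨1, Diagram.straight n⟩

end BubbleDiagram

/-- The diagrammatic algebra: the complex vector space with basis the `n`-diagrams. -/
def DiagramAlgebra (n : ℕ) (_δ : ℂ) : Type := Diagram n →₀ ℂ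

namespace DiagramAlgebra
variable {n : ℕ} {δ : ℂ}

noncomputable instance : AddCommGroup (DiagramAlgebra n δ) :=
  inferInstanceAs (AddCommGroup (Diagram n →₀ ℂ))

noncomputable instance : Module ℂ (DiagramAlgebra n δ) :=
  inferInstanceAs (Module ℂ (Diagram n →₀ ℂ))

/-- The basis vector of the diagrammatic algebra given by a diagram. -/
noncomputable def of (δ : ℂ) (d : Diagram n) : DiagramAlgebra n δ := Finsupp.single d (1 : ℂ)

/-- The multiplication: the bilinear map sending a pair of diagrams `d`, `e` to the diagram obtained by
placing `e` on top of `d`, each bubble being replaced by the scalar `δ`. -/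
noncomputable def mulMap (n : ℕ) (δ : ℂ) :
    DiagramAlgebra n δ →ₗ[ℂ] DiagramAlgebra n δ →ₗ[ℂ] DiagramAlgebra n δ :=
  Finsupp.linearCombination ℂ fun d : Diagram n =>
    (Finsupp.linearCombination ℂ fun e : Diagram n =>
      δ ^ Diagram.bubbles d e • of δ (Diagram.comp d e) : (Diagram n →₀ ℂ) →ₗ[ℂ] DiagramAlgebra n δ)

theorem mulMap_of (d e : Diagram n) :
    mulMap n δ (of δ d) (of δ e) = δ ^ Diagram.bubbles d e • of δ (Diagram.comp d e) := by
  unfold mulMap of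
  erw [Finsupp.linearCombination_single, one_smul, Finsupp.linearCombination_single, one_smul]

theorem induction_of {P : DiagramAlgebra n δ → Prop} (h0 : P 0) (hadd : ∀ x y, P x → P y → P (x + y))
    (hof : ∀ (a : ℂ) d, P (a • of δ d)) (x : DiagramAlgebra n δ) : P x := by
  refine Finsupp.induction_linear (motive := P) x h0 hadd fun d a => ?_
  have h := hof a d
  have e : (a • of δ d : DiagramAlgebra n δ) = Finsupp.single d a := by
    unfold of
    exact (Finsupp.smul_single a d (1 : ℂ)).trans (by rw [smul_eq_mul, mul_one])
  rwa [e] at h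

theorem mulMap_assoc (x y z : DiagramAlgebra n δ) :
    mulMap n δ (mulMap n δ x y) z = mulMap n δ x (mulMap n δ y z) := by
  induction x using induction_of with
  | h0 => simp
  | hadd x x' h1 h2 => simp only [map_add, LinearMap.add_apply, h1, h2]
  | hof a d =>
    induction y using induction_of with
    | h0 => simp
    | hadd x x' h1 h2 => simp only [map_add, LinearMap.add_apply, h1, h2]
    | hof b e =>
      induction z using induction_of with
      | h0 => simp
      | hadd x x' h1 h2 => simp only [map_add, h1, h2]
      | hof c f =>
        simp only [map_smul, LinearMap.smul_apply, mulMap_of, smul_smul, Diagram.comp_assoc]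
        congr 1
        have h := congrArg (δ ^ ·) (Diagram.bubbles_assoc d e f)
        simp only [pow_add] at h
        linear_combination a * b * c * h

theorem one_mulMap (x : DiagramAlgebra n δ) : mulMap n δ (of δ (Diagram.straight n)) x = x := by
  induction x using induction_of with
  | h0 => simp
  | hadd x x' h1 h2 => simp only [map_add, h1, h2]
  | hof a d =>
    rw [map_smul, mulMap_of, Diagram.bubbles_straight_left, Diagram.straight_comp, pow_zero, one_smul]

theorem mulMap_one (x : DiagramAlgebra n δ) : mulMap n δ x (of δ (Diagram.straight n)) = x := by
  induction x using induction_of with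
  | h0 => simp
  | hadd x x' h1 h2 => simp only [map_add, LinearMap.add_apply, h1, h2]
  | hof a d =>
    rw [map_smul, LinearMap.smul_apply, mulMap_of, Diagram.bubbles_straight_right,
      Diagram.comp_straight, pow_zero, one_smul]

noncomputable instance : Ring (DiagramAlgebra n δ) where
  __ := (inferInstance : AddCommGroup (DiagramAlgebra n δ))
  mul x y := mulMap n δ x y
  one := of δ (Diagram.straight n)
  left_distrib x y z := map_add (mulMap n δ x) y z
  right_distrib x y z := LinearMap.map_add₂ (mulMap n δ) x y z
  zero_mul x := LinearMap.map_zero₂ (mulMap n δ) x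
  mul_zero x := map_zero (mulMap n δ x)
  mul_assoc := mulMap_assoc
  one_mul := one_mulMap
  mul_one := mulMap_one

noncomputable instance : Algebra ℂ (DiagramAlgebra n δ) :=
  Algebra.ofModule (fun a x y => LinearMap.map_smul₂ (mulMap n δ) a x y)
    (fun a x y => map_smul (mulMap n δ x) a y)

end DiagramAlgebra

/-- The letters of the antidiagonal `E i, E (i - 1), …, E j`. -/
def antidiagonal {n : ℕ} (i j : Fin (n - 1)) : List (Fin (n - 1)) :=
  (List.finRange (n - 1)).reverse.filter fun k => j ≤ k ∧ k ≤ i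

/-- The data `(i₁, j₁), …, (i_r, j_r)` of a Jones normal form (without bubble factor): `j_k ≤ i_k`,
`i₁ < ⋯ < i_r` and `j₁ < ⋯ < j_r`. For `r = 0` this is the empty word. -/
@[ext]
structure JonesForm (n : ℕ) where
  blocks : List (Fin (n - 1) × Fin (n - 1))
  le : ∀ b ∈ blocks, b.2 ≤ b.1
  increasing : blocks.Pairwise fun b c => b.1 < c.1 ∧ b.2 < c.2

namespace JonesForm
variable {n : ℕ}

/-- The word `(i₁, i₁ - 1, …, j₁, …, i_r, i_r - 1, …, j_r)`. -/
def letters (w : JonesForm n) : List (Fin (n - 1)) := w.blocks.flatMap fun b => antidiagonal b.1 b.2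

/-- The product `(E_{i₁} ⋯ E_{j₁}) ⋯ (E_{i_r} ⋯ E_{j_r})` in the monoid of diagrams with bubbles. -/
noncomputable def toBubbleDiagram (w : JonesForm n) : BubbleDiagram n :=
  (w.letters.map fun k => BubbleDiagram.of (Diagram.E k)).prod

/-- The product `(E_{i₁} ⋯ E_{j₁}) ⋯ (E_{i_r} ⋯ E_{j_r})` in the diagrammatic algebra. -/
noncomputable def toAlgebra (δ : ℂ) (w : JonesForm n) : DiagramAlgebra n δ :=
  (w.letters.map fun k => DiagramAlgebra.of δ (Diagram.E k)).prod

end JonesForm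

end TemperleyLieb

/-! The indices of a Jones normal form can be read off its diagram. Call a column `k` bottom-left if
the bottom point `k` is linked to a smaller column, and top-right if the top point `k` is linked to
a larger one. With columns counted from 0, the product of blocks `(i₁, j₁), …, (i_r, j_r)` creates
no bubble, its bottom-left columns are exactly the `i_k + 1`, and its top-right columns are exactly
the `j_k`. Both index sequences are strictly increasing, so these two sets determine them; this
gives uniqueness.

The product is built from its last letter to its first, each new generator being glued below. A
generator `E i` starting a new block meets a vertical link in column `i`, adding `i + 1` to the
bottom-left columns and `i` to the top-right ones (`E_comp_of_vertical`). A generator lengthening a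
block meets the cup left by the preceding generator, and only shifts one bottom-left column to the
right by one (`E_comp_of_cup`).

Conversely, the smallest bottom-left column `j + 1` of a diagram belongs to a cup at `j`, `j + 1`
(`link_hi_of_minimal`), and `E j` can be split off below: either all columns left of `j` are
vertical and `E j` is a whole block, or the remaining diagram has a cup at `j - 1`, `j` and `E j`
extends its first block. The sum of the bottom-left columns drops each time, so the descent stops at
the straight diagram (`exists_jonesForm`).

Normal forms are thus in bijection with diagrams. The homomorphism `evalHom` carries this to the
algebra, where the products are the diagram basis reindexed. -/

namespace TemperleyLieb
open Relation Stack

/-! ### Columns, bottom-left and top-right points, the cup of a generator. -/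

namespace Diagram
variable {n : ℕ}

/-- The column of a marked point. -/
def col : Point n → ℕ
  | Sum.inl i => i
  | Sum.inr i => i

@[simp] theorem col_inl (i : Fin n) : col (Sum.inl i : Point n) = i := rfl
@[simp] theorem col_inr (i : Fin n) : col (Sum.inr i : Point n) = i := rfl

/-- The `k`-th bottom point is linked to a point of a smaller column. -/
def BottomLeft (d : Diagram n) (k : ℕ) : Prop :=
  ∃ h : k < n, col (d.link (Sum.inl ⟨k, h⟩)) < k

/-- The `k`-th top point is linked to a point of a larger column. -/
def TopRight (d : Diagram n) (k : ℕ) : Prop :=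
  ∃ h : k < n, k < col (d.link (Sum.inr ⟨k, h⟩))

/-- The left bottom point of the cup of `E i`. -/
def lo (i : Fin (n - 1)) : Point n := Sum.inl ⟨i, by omega⟩

/-- The right bottom point of the cup of `E i`. -/
def hi (i : Fin (n - 1)) : Point n := Sum.inl ⟨i + 1, by omega⟩

@[simp] theorem col_lo (i : Fin (n - 1)) : col (lo i) = i := rfl
@[simp] theorem col_hi (i : Fin (n - 1)) : col (hi i) = i + 1 := rfl
@[simp] theorem pos_lo (i : Fin (n - 1)) : pos (lo i) = i := rfl
@[simp] theorem pos_hi (i : Fin (n - 1)) : pos (hi i) = i + 1 := rfl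

@[simp] theorem pos_inl (i : Fin n) : pos (Sum.inl i : Point n) = i := rfl
@[simp] theorem pos_inr (i : Fin n) : pos (Sum.inr i : Point n) = 2 * n - 1 - i := rfl

theorem lo_ne_hi (i : Fin (n - 1)) : lo i ≠ hi i := by
  simp [lo, hi]

theorem inl_eq_lo (k : Fin n) (i : Fin (n - 1)) : Sum.inl k = lo i ↔ k.val = i.val := by
  simp [lo, Fin.ext_iff]

theorem inl_eq_hi (k : Fin n) (i : Fin (n - 1)) : Sum.inl k = hi i ↔ k.val = i.val + 1 := by
  simp [hi, Fin.ext_iff]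

theorem inr_ne_lo (k : Fin n) (i : Fin (n - 1)) : Sum.inr k ≠ lo i := nofun

theorem inr_ne_hi (k : Fin n) (i : Fin (n - 1)) : Sum.inr k ≠ hi i := nofun

theorem link_eq_comm (d : Diagram n) {a b : Point n} : d.link a = b ↔ a = d.link b :=
  ⟨fun h => by rw [← h, d.link_link], fun h => by rw [h, d.link_link]⟩

theorem link_injective (d : Diagram n) : Function.Injective d.link := fun a b h => by
  rw [← d.link_link a, h, d.link_link]

theorem pos_injective : Function.Injective (pos (n := n)) := by
  rintro (a | a) (b | b) h <;> simp only [pos] at h <;>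
    first | (congr 1; apply Fin.ext; omega) | (exfalso; omega)

/-! ### Gluing a generator below a diagram. -/

theorem E_link_inl_of_ne (i : Fin (n - 1)) (k : Fin n) (h1 : Sum.inl k ≠ lo i)
    (h2 : Sum.inl k ≠ hi i) : (E i).link (Sum.inl k) = Sum.inr k := by
  rw [Ne, inl_eq_lo] at h1
  rw [Ne, inl_eq_hi] at h2
  simp [E, h1, h2]

/-- Away from its cup, `E i` is vertical on the bottom side, so the outer boundary can be identified
there with the boundary of the upper rectangle. On the top side the two points are literally the
same point of the stack. -/
theorem conn_outer_upper (i : Fin (n - 1)) (d : Diagram n) (a : Point n) (h1 : a ≠ lo i)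
    (h2 : a ≠ hi i) : conn (E i) d (outer a) (upper a) := by
  rcases a with k | k
  · exact .rel _ _ (.inl ⟨Sum.inl k, rfl, by rw [E_link_inl_of_ne i k h1 h2]; rfl⟩)
  · exact .refl _

theorem conn_upper_link (e d : Diagram n) (a : Point n) :
    conn e d (upper a) (upper (d.link a)) := .rel _ _ (.inr ⟨a, rfl, rfl⟩)

theorem conn_cap (i : Fin (n - 1)) (d : Diagram n) :
    conn (E i) d (upper (lo i)) (upper (hi i)) :=
  .rel _ _ (.inl ⟨Sum.inr ⟨i, by omega⟩, rfl, by simp [E, hi, upper, lower]⟩)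

theorem conn_cup (i : Fin (n - 1)) (d : Diagram n) :
    conn (E i) d (outer (lo i)) (outer (hi i)) :=
  .rel _ _ (.inl ⟨Sum.inl ⟨i, by omega⟩, rfl, by simp [E, hi, outer, lower]⟩)

/-- The links of the product `E i * d` when no bubble appears. -/
theorem E_comp_link (i : Fin (n - 1)) (d : Diagram n) (h : d.link (lo i) ≠ hi i) (a : Point n) :
    (comp (E i) d).link a =
      if a = lo i then hi i else if a = hi i then lo i
      else if a = d.link (lo i) then d.link (hi i)
      else if a = d.link (hi i) then d.link (lo i) else d.link a := by
  have h' : d.link (hi i) ≠ lo i := fun h2 => h (by rw [← h2, d.link_link])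
  -- The two links of `d` ending at `lo i` and `hi i` are spliced through the cap of `E i`. Their
  -- other ends avoid `lo i` and `hi i`, hence reach the outer boundary.
  have key : conn (E i) d (outer (d.link (lo i))) (outer (d.link (hi i))) := by
    refine (conn (E i) d).trans (conn_outer_upper i d _ (d.link_ne _) h) ?_
    refine (conn (E i) d).trans ((conn (E i) d).symm (conn_upper_link _ d _)) ?_
    refine (conn (E i) d).trans (conn_cap i d) ?_
    refine (conn (E i) d).trans (conn_upper_link _ d _) ?_
    exact (conn (E i) d).symm (conn_outer_upper i d _ h' (d.link_ne _))
  have hne : d.link (lo i) ≠ d.link (hi i) := fun h => lo_ne_hi i (d.link_injective h)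
  symm
  -- Partners are unique, so a connected point different from `a` suffices.
  refine eq_compLink (E i) d a _ ?_ ?_
  · split_ifs with h1 h2 h3 h4
    · exact fun h => lo_ne_hi i (h1 ▸ h.symm)
    · exact fun h => lo_ne_hi i (h2 ▸ h)
    · exact fun h => hne (h3 ▸ h.symm)
    · exact fun h => hne (h4 ▸ h)
    · exact d.link_ne a
  · split_ifs with h1 h2 h3 h4
    · exact h1 ▸ conn_cup i d
    · exact h2 ▸ (conn (E i) d).symm (conn_cup i d)
    · exact h3 ▸ key
    · exact h4 ▸ (conn (E i) d).symm key
    · refine (conn (E i) d).trans (conn_outer_upper i d a h1 h2) ?_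
      refine (conn (E i) d).trans (conn_upper_link _ d _) ?_
      refine (conn (E i) d).symm (conn_outer_upper i d _ ?_ ?_)
      · rw [Ne, link_eq_comm]; exact h3
      · rw [Ne, link_eq_comm]; exact h4

/-- Only the two middle points on the cap of `E i` are not directly joined to the bottom side. Both
lie on the path through `d.link (lo i)`, which leaves the middle because `d` does not close the cap.
-/
theorem bubbles_E (i : Fin (n - 1)) (d : Diagram n) (h : d.link (lo i) ≠ hi i) :
    bubbles (E i) d = 0 := by
  have out : ∀ x a, conn (E i) d x (outer a) →
      ∃ j, conn (E i) d x (bot j) ∨ conn (E i) d x (top j) := by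
    rintro x (j | j) hx
    exacts [⟨j, .inl hx⟩, ⟨j, .inr hx⟩]
  have hlo : conn (E i) d (upper (lo i)) (outer (d.link (lo i))) :=
    (conn (E i) d).trans (conn_upper_link _ d _)
      ((conn (E i) d).symm (conn_outer_upper i d _ (d.link_ne _) h))
  refine bubbles_eq_zero _ _ fun k => ?_
  change ∃ j, conn (E i) d (upper (Sum.inl k)) _ ∨ conn (E i) d (upper (Sum.inl k)) _
  by_cases h1 : Sum.inl k = lo i
  · rw [h1]; exact out _ _ hlo
  by_cases h2 : Sum.inl k = hi i
  · rw [h2]; exact out _ _ ((conn (E i) d).trans ((conn (E i) d).symm (conn_cap i d)) hlo)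
  · exact out _ _ ((conn (E i) d).symm (conn_outer_upper i d _ h1 h2))

theorem le_col_link_hi {d : Diagram n} {i : Fin (n - 1)} (h : ¬ BottomLeft d (i + 1)) :
    i + 1 ≤ col (d.link (hi i)) :=
  not_lt.1 fun h' => h ⟨by omega, h'⟩

/-- Multiplication by `E (i + 1)` of a diagram with cup `i`, `i + 1`. -/
theorem E_comp_of_cup (d : Diagram n) (i j : Fin (n - 1)) (hij : j.val = i.val + 1)
    (hcup : d.link (hi i) = lo i) (h : ¬ BottomLeft d (j + 1)) :
    bubbles (E j) d = 0 ∧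
    (∀ k, BottomLeft (comp (E j) d) k ↔ k = j + 1 ∨ BottomLeft d k ∧ k ≠ j) ∧
    ∀ k, TopRight (comp (E j) d) k ↔ TopRight d k := by
  have e : lo j = hi i := by simp [lo, hi, hij]
  have hne : d.link (lo j) ≠ hi j := by
    rw [e, hcup]; simp [lo, hi]; omega
  -- Let `z` be the partner of `hi j`, in a column at least `j + 1`. In the product it is linked to
  -- `lo i` instead, still weakly to its left, so the status of `z` is unchanged. The point `lo i`
  -- was linked to the right and still is; `lo j` now points right and `hi j` left.
  have hz := le_col_link_hi h
  have hl := E_comp_link j d hne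
  rw [e, hcup, ← e] at hl
  have hcup' : d.link (lo i) = lo j := by rw [e, ← hcup, d.link_link]
  refine ⟨bubbles_E j d hne, fun k => ?_, fun k => ?_⟩
  · by_cases hk : k < n
    swap
    · exact ⟨fun ⟨h, _⟩ => absurd h hk, by rintro (rfl | ⟨⟨h, _⟩, _⟩) <;> omega⟩
    simp only [BottomLeft, hk, exists_true_left, hl]
    have := d.link_link (hi j)
    split_ifs with h1 h2 h3 h4
    · rw [inl_eq_lo] at h1
      simp only [col_hi] at *; omega
    · rw [inl_eq_hi] at h2
      simp only [col_lo] at *; omega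
    · rw [h3, hcup']
      rw [inl_eq_lo] at h3
      simp only [col_lo] at *; omega
    · rw [h4, this]
      rw [← h4] at hz
      rw [inl_eq_lo] at h1
      rw [inl_eq_hi] at h2
      simp only [col_lo, col_hi, col_inl] at *; omega
    · rw [inl_eq_lo] at h1
      rw [inl_eq_hi] at h2
      simp only at h1 h2
      simp [h1, h2]
  · by_cases hk : k < n
    swap
    · exact ⟨fun ⟨h, _⟩ => absurd h hk, fun ⟨h, _⟩ => absurd h hk⟩
    simp only [TopRight, hk, exists_true_left, hl, inr_ne_lo, inr_ne_hi, if_false]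
    split_ifs with h4
    · rw [h4, d.link_link]
      rw [← h4] at hz
      simp only [col_lo, col_hi, col_inr] at *; omega
    · rfl

/-- The vertical link at `i` is replaced by a cup at `i`, `i + 1`, and the top point `i` inherits
the partner of `hi i`, which lies in a column at least `i + 1`. So a bottom-left and a top-right
column appear, and that partner keeps its status. -/
theorem E_comp_of_vertical (d : Diagram n) (i : Fin (n - 1))
    (hv : d.link (lo i) = Sum.inr ⟨i, by omega⟩) (h : ¬ BottomLeft d (i + 1)) :
    bubbles (E i) d = 0 ∧
    (∀ k, BottomLeft (comp (E i) d) k ↔ k = i + 1 ∨ BottomLeft d k) ∧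
    ∀ k, TopRight (comp (E i) d) k ↔ k = i ∨ TopRight d k := by
  have hne : d.link (lo i) ≠ hi i := by rw [hv]; exact nofun
  have hz := le_col_link_hi h
  have hl := E_comp_link i d hne
  rw [hv] at hl
  refine ⟨bubbles_E i d hne, fun k => ?_, fun k => ?_⟩
  · by_cases hk : k < n
    swap
    · exact ⟨fun ⟨h, _⟩ => absurd h hk, by rintro (rfl | ⟨h, _⟩) <;> omega⟩
    simp only [BottomLeft, hk, exists_true_left, hl, reduceCtorEq, if_false]
    split_ifs with h1 h2 h4
    · rw [h1, hv]
      rw [inl_eq_lo] at h1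
      simp only [col_hi, col_inr] at *; omega
    · rw [inl_eq_hi] at h2
      simp only [col_lo] at *; omega
    · rw [h4, d.link_link]
      rw [← h4] at hz
      rw [inl_eq_hi] at h2
      simp only [col_inr, col_hi, col_inl] at *; omega
    · rw [inl_eq_hi] at h2
      simp only at h2
      simp [h2]
  · by_cases hk : k < n
    swap
    · exact ⟨fun ⟨h, _⟩ => absurd h hk, by rintro (rfl | ⟨h, _⟩) <;> omega⟩
    simp only [TopRight, hk, exists_true_left, hl, inr_ne_lo, inr_ne_hi, if_false,
      Sum.inr.injEq, Fin.ext_iff]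
    split_ifs with h3 h4
    · omega
    · rw [h4, d.link_link]
      rw [← h4] at hz
      simp only [col_inr, col_hi] at *; omega
    · simp [h3]

/-! ### Shape of a diagram forced by its bottom-left and top-right columns. -/

/-- Sweep from left to right: the top point `k` may only be linked to a column at most `k`, and the
smaller columns are already used up by vertical links. -/
theorem vertical_of_not_topRight (d : Diagram n) (i : ℕ) (h : ∀ k ≤ i, ¬ TopRight d k) :
    ∀ (k : ℕ) (hk : k < n), k ≤ i → d.link (Sum.inl ⟨k, hk⟩) = Sum.inr ⟨k, hk⟩ := by
  intro k
  induction k using Nat.strong_induction_on with | _ k ih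
  intro hk hki
  have h1 : col (d.link (Sum.inr ⟨k, hk⟩)) ≤ k := not_lt.1 fun h' => h k hki ⟨hk, h'⟩
  rw [link_eq_comm, eq_comm]
  rcases hm : d.link (Sum.inr ⟨k, hk⟩) with m | m
  · rw [hm, col_inl] at h1
    rcases h1.lt_or_eq with h1 | h1
    · have := ih m h1 m.2 (by omega)
      rw [← hm, d.link_link] at this
      simp only [Sum.inr.injEq, Fin.ext_iff] at this
      omega
    · simp [Fin.ext_iff, h1]
  · rw [hm, col_inr] at h1
    rcases h1.lt_or_eq with h1 | h1
    · have := ih m h1 m.2 (by omega)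
      rw [link_eq_comm, ← hm, d.link_link] at this
      cases this
    · exact absurd (hm.trans (by simp [Fin.ext_iff, h1])) (d.link_ne _)

/-- Otherwise the leftward link from `hi i` separates `lo i` from every admissible partner:
noncrossing would send `lo i` to a column smaller than `i`, against minimality. -/
theorem link_hi_of_minimal (d : Diagram n) (i : Fin (n - 1)) (h : ∀ k ≤ i.val, ¬ BottomLeft d k)
    (h1 : BottomLeft d (i + 1)) : d.link (hi i) = lo i := by
  have hc : col (d.link (hi i)) < i + 1 := h1.2
  have hlo : i ≤ col (d.link (lo i)) := not_lt.1 fun h' => h i le_rfl ⟨by omega, h'⟩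
  by_contra hne
  have hne' : d.link (lo i) ≠ hi i := fun h => hne (by rw [← h, d.link_link])
  have n1 := d.noncrossing (lo i) (hi i)
  have n2 := d.noncrossing (d.link (hi i)) (lo i)
  have hd : d.link (lo i) ≠ d.link (hi i) := fun h => lo_ne_hi i (d.link_injective h)
  have hs := d.link_ne (lo i)
  rw [d.link_link] at n2
  rcases hm : d.link (hi i) with m | m <;> rcases hk : d.link (lo i) with k | k <;>
    simp only [hm, hk, Ne, Sum.inl.injEq, Sum.inr.injEq, Fin.ext_iff, inl_eq_lo, inl_eq_hi, pos_inl,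
      pos_inr, pos_lo, pos_hi, col_inl, col_inr] at * <;> omega

/-- Sweep from right to left: a link from bottom `k` to a bottom point further right would make that
point bottom-left, and the top points further right are already taken. -/
theorem eq_straight (d : Diagram n) (h : ∀ k, ¬ BottomLeft d k) : d = straight n := by
  have key : ∀ m k : ℕ, ∀ hk : k < n, k + m + 1 = n →
      d.link (Sum.inl ⟨k, hk⟩) = Sum.inr ⟨k, hk⟩ := by
    intro m
    induction m using Nat.strong_induction_on with | _ m ih
    intro k hk hkm
    have h1 : k ≤ col (d.link (Sum.inl ⟨k, hk⟩)) := not_lt.1 fun h' => h k ⟨hk, h'⟩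
    rcases hm : d.link (Sum.inl ⟨k, hk⟩) with j | j
    · rw [hm, col_inl] at h1
      rcases h1.lt_or_eq with h1 | h1
      · refine absurd ⟨j.2, ?_⟩ (h j)
        rw [← hm, d.link_link]; exact h1
      · exact absurd (hm.trans (by simp [h1])) (d.link_ne _)
    · rw [hm, col_inr] at h1
      rcases h1.lt_or_eq with h1 | h1
      · have := ih (n - 1 - j) (by omega) j j.2 (by omega)
        rw [link_eq_comm, ← link_eq_comm, link_eq_comm, ← hm, d.link_link] at this
        simp only [Sum.inl.injEq, Fin.ext_iff] at this
        omega
      · simp [h1]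
  ext1
  funext a
  rcases a with a | a
  · exact key (n - 1 - a) a a.2 (by omega)
  · exact ((d.link_eq_comm).1 (key (n - 1 - a) a a.2 (by omega))).symm

theorem not_bottomLeft_zero (d : Diagram n) : ¬ BottomLeft d 0 := fun ⟨_, h⟩ => by omega

end Diagram
end TemperleyLieb

/-! ### Splitting off a generator from below. -/

namespace TemperleyLieb
open Relation Stack

namespace Diagram
variable {n : ℕ}

theorem bijOn_pos : Set.BijOn (pos (n := n)) (Finset.univ : Finset (Point n))
    (Finset.range (2 * n)) := by
  refine ⟨fun a _ => ?_, pos_injective.injOn, fun m hm => ?_⟩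
  · rcases a with a | a <;> simp <;> omega
  · rw [Finset.coe_range, Set.mem_Iio] at hm
    by_cases h : m < n
    · exact ⟨Sum.inl ⟨m, h⟩, by simp, rfl⟩
    · exact ⟨Sum.inr ⟨2 * n - 1 - m, by omega⟩, by simp, by simp; omega⟩

/-- A link encloses an even number of points. -/
theorem odd_pos_add_pos_link (d : Diagram n) (a : Point n) (ha : pos a < pos (d.link a)) :
    (pos a + pos (d.link a)) % 2 = 1 := by
  classical
  -- By noncrossing, `link` preserves the set of enclosed points, so its cardinality is even. Since
  -- `pos` fills an interval, that cardinality is the number of integers between the two ends.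
  have h := sum_invariant d (fun b => if pos a < pos b ∧ pos b < pos (d.link a) then 1 else 0) ?_
  · rw [Finset.sum_boole, ZMod.natCast_eq_zero_iff] at h
    have hb : pos (d.link a) < 2 * n := by
      simpa using bijOn_pos.1 (Finset.mem_coe.2 (Finset.mem_univ (d.link a)))
    have hc : (Finset.univ.filter fun b : Point n => pos a < pos b ∧ pos b < pos (d.link a)).card =
        (Finset.Ioo (pos a) (pos (d.link a))).card := by
      refine Finset.card_bij (fun b _ => pos b) ?_ (fun _ _ _ _ h => pos_injective h) ?_
      · intro b hb; simpa using hb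
      · intro m hm
        rw [Finset.mem_Ioo] at hm
        obtain ⟨b, -, rfl⟩ := bijOn_pos.2.2 (Finset.mem_coe.2 (Finset.mem_range.2 (hm.2.trans hb)))
        exact ⟨b, by simpa using hm, rfl⟩
    rw [hc, Nat.card_Ioo] at h
    omega
  · intro b
    have h1 := d.noncrossing a b
    have h2 := d.noncrossing b a
    have h3 := d.noncrossing a (d.link b)
    have h4 := d.noncrossing (d.link b) a
    rw [d.link_link] at h3 h4
    by_cases hab : b = a
    · subst hab; simp
    by_cases hab' : b = d.link a
    · subst hab'; simp [d.link_link]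
    have n1 : pos b ≠ pos a := fun h => hab (pos_injective h)
    have n2 : pos b ≠ pos (d.link a) := fun h => hab' (pos_injective h)
    have n3 : pos (d.link b) ≠ pos a := fun h => hab' (d.link_eq_comm.1 (pos_injective h))
    have n4 : pos (d.link b) ≠ pos (d.link a) :=
      fun h => hab (d.link_injective (pos_injective h))
    congr 1
    refine propext ?_
    omega

/-- If the diagram links the bottom points `i`, `i + 1` and all previous columns are vertical, then
it is the product of `E i` and of a diagram whose first columns are vertical. -/
theorem exists_E_comp_of_vertical (d : Diagram n) (i : Fin (n - 1)) (hcup : d.link (hi i) = lo i)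
    (hv : ∀ (k : ℕ) (hk : k < n), k < i → d.link (Sum.inl ⟨k, hk⟩) = Sum.inr ⟨k, hk⟩) :
    ∃ d' : Diagram n, comp (E i) d' = d ∧ (∀ k ≤ i.val + 1, ¬ BottomLeft d' k) ∧
      (∀ k ≤ i.val, ¬ TopRight d' k) ∧ d'.link (lo i) = Sum.inr ⟨i, by omega⟩ := by
  set t : Point n := Sum.inr ⟨i, by omega⟩ with ht
  set z : Point n := d.link t with hz
  have hcup' : d.link (lo i) = hi i := by rw [← hcup, d.link_link]
  have hzt : d.link z = t := by rw [hz, d.link_link]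
  have htl : t ≠ lo i := nofun
  have hth : t ≠ hi i := nofun
  have hlh := lo_ne_hi i
  have hzt' : z ≠ t := d.link_ne t
  have hzl : z ≠ lo i := fun h => hth (by rw [← hzt, h, hcup'])
  have hzh : z ≠ hi i := fun h => htl (by rw [← hzt, h, hcup])
  have pt : pos t = 2 * n - 1 - i := rfl
  -- Every remaining point is on a vertical link left of column `i`, or lies strictly between `hi i`
  -- and `t` along the boundary.
  have side : ∀ a : Point n, a ≠ lo i → a ≠ hi i → a ≠ t →
      (pos a < i ∧ pos (d.link a) = 2 * n - 1 - pos a ∨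
        pos (d.link a) < i ∧ pos a = 2 * n - 1 - pos (d.link a) ∨
        i + 1 < pos a ∧ pos a < pos t) := by
    intro a h1 h2 h3
    rcases a with k | k
    · rw [Ne, inl_eq_lo] at h1
      rw [Ne, inl_eq_hi] at h2
      by_cases hk : k.val < i
      · have := hv k k.2 hk
        simp only [Fin.eta] at this
        rw [this]; simp; omega
      · simp only [pos_inl, pt]; omega
    · simp only [ht, Ne, Sum.inr.injEq, Fin.ext_iff] at h3
      by_cases hk : k.val < i
      · have := hv k k.2 hk
        simp only [Fin.eta] at this
        rw [link_eq_comm] at this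
        rw [← this]; simp; omega
      · simp only [pos_inr, pt]; omega
  have hzs : i + 1 < pos z ∧ pos z < pos t := by
    rcases side z hzl hzh hzt' with h | h | h
    · rw [hzt, pt] at h
      omega
    · rw [hzt, pt] at h; omega
    · exact h
  -- Undo the gluing: the links `lo i`–`hi i` and `t`–`z` become `lo i`–`t` and `hi i`–`z`.
  let L : Point n → Point n := fun a =>
    if a = lo i then t else if a = t then lo i else if a = hi i then z else if a = z then hi i
    else d.link a
  have Ll : L (lo i) = t := if_pos rfl
  have Lt : L t = lo i := by simp [L, htl]
  have Lh : L (hi i) = z := by simp [L, hlh.symm, hth.symm]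
  have Lz : L z = hi i := by simp [L, hzl, hzt', hzh]
  have Lo : ∀ a, a ≠ lo i → a ≠ t → a ≠ hi i → a ≠ z → L a = d.link a := by
    intro a h1 h2 h3 h4
    simp [L, h1, h2, h3, h4]
  have cases5 : ∀ a, a = lo i ∨ a = t ∨ a = hi i ∨ a = z ∨
      (a ≠ lo i ∧ a ≠ t ∧ a ≠ hi i ∧ a ≠ z) := fun a => by tauto
  have hother : ∀ a, (a ≠ lo i ∧ a ≠ t ∧ a ≠ hi i ∧ a ≠ z) →
      (d.link a ≠ lo i ∧ d.link a ≠ t ∧ d.link a ≠ hi i ∧ d.link a ≠ z) := by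
    rintro a ⟨h1, h2, h3, h4⟩
    simp only [Ne, link_eq_comm]
    rw [hcup', hcup, hzt]
    exact ⟨h3, h4, h1, h2⟩
  let d' : Diagram n :=
    { link := L
      link_link := by
        intro a
        rcases cases5 a with rfl | rfl | rfl | rfl | h
        · rw [Ll, Lt]
        · rw [Lt, Ll]
        · rw [Lh, Lz]
        · rw [Lz, Lh]
        · obtain ⟨h1, h2, h3, h4⟩ := hother a h
          rw [Lo a h.1 h.2.1 h.2.2.1 h.2.2.2, Lo _ h1 h2 h3 h4, d.link_link]
      link_ne := by
        intro a
        rcases cases5 a with rfl | rfl | rfl | rfl | h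
        · rw [Ll]; exact htl
        · rw [Lt]; exact htl.symm
        · rw [Lh]; exact hzh
        · rw [Lz]; exact hzh.symm
        · rw [Lo a h.1 h.2.1 h.2.2.1 h.2.2.2]; exact d.link_ne a
      noncrossing := by
        -- The link `t`–`z` of `d` already separates the untouched links: each one encloses both new
        -- links, or stays between `hi i` and `z`, or stays between `z` and `t`.
        have facts : ∀ a, (a ≠ lo i ∧ a ≠ t ∧ a ≠ hi i ∧ a ≠ z) →
            (pos a < i ∧ pos t < pos (d.link a) ∨ pos (d.link a) < i ∧ pos t < pos a ∨
            i + 1 < pos a ∧ pos a < pos z ∧ i + 1 < pos (d.link a) ∧ pos (d.link a) < pos z ∨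
            pos z < pos a ∧ pos a < pos t ∧ pos z < pos (d.link a) ∧ pos (d.link a) < pos t) := by
          intro a h
          have h' := hother a h
          have s1 := side a h.1 h.2.2.1 h.2.1
          have s2 := side _ h'.1 h'.2.2.1 h'.2.1
          have c1 := d.noncrossing a z
          have c2 := d.noncrossing (d.link a) z
          have c3 := d.noncrossing z a
          have c4 := d.noncrossing z (d.link a)
          rw [hzt] at c3 c4
          have n1 : pos a ≠ pos z := fun e => h.2.2.2 (pos_injective e)
          have n2 : pos (d.link a) ≠ pos z := fun e => h'.2.2.2 (pos_injective e)
          rw [d.link_link] at s2 c2 c4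
          rw [hzt] at c1 c2
          omega
        intro a b
        rcases cases5 a with rfl | rfl | rfl | rfl | ha <;>
          rcases cases5 b with rfl | rfl | rfl | rfl | hb <;>
          (try simp only [Ll, Lt, Lh, Lz, pos_lo, pos_hi]) <;>
          first
          | omega
          | rw [Lo b hb.1 hb.2.1 hb.2.2.1 hb.2.2.2]; have := facts b hb; omega
          | rw [Lo a ha.1 ha.2.1 ha.2.2.1 ha.2.2.2]; have := facts a ha; omega
          | skip
        rw [Lo a ha.1 ha.2.1 ha.2.2.1 ha.2.2.2, Lo b hb.1 hb.2.1 hb.2.2.1 hb.2.2.2]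
        exact d.noncrossing a b }
  have hne : d'.link (lo i) ≠ hi i := by
    change L (lo i) ≠ _
    rw [Ll]; exact hth
  refine ⟨d', ?_, ?_, ?_, Ll⟩
  · ext1
    funext a
    rw [E_comp_link i d' hne]
    change (if a = lo i then hi i else if a = hi i then lo i else if a = L (lo i) then L (hi i)
      else if a = L (hi i) then L (lo i) else L a) = _
    rw [Ll, Lh]
    split_ifs with h1 h2 h3 h4
    · rw [h1, hcup']
    · rw [h2, hcup]
    · rw [h3]
    · rw [h4, hzt]
    · exact Lo a h1 h3 h2 h4
  · rintro k hk ⟨hkn, h⟩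
    change col (L (Sum.inl ⟨k, hkn⟩)) < k at h
    by_cases h1 : k = i
    · subst h1
      change col (L (lo i)) < _ at h
      rw [Ll] at h; simp [ht] at h
    by_cases h2 : k = i + 1
    · subst h2
      change col (L (hi i)) < _ at h
      rw [Lh] at h
      -- Lying strictly between `hi i` and `t`, the point `z` is in a column at least `i + 1`, on
      -- whichever side it is.
      rcases hzz : z with m | m <;> rw [hzz] at h hzs <;>
        simp only [col_inl, col_inr, pos_inl, pos_inr, pt] at h hzs <;> omega
    · have hne1 : (Sum.inl ⟨k, hkn⟩ : Point n) ≠ lo i := by rw [Ne, inl_eq_lo]; exact h1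
      have hne2 : (Sum.inl ⟨k, hkn⟩ : Point n) ≠ hi i := by rw [Ne, inl_eq_hi]; exact h2
      rw [Lo _ hne1 (by exact nofun) hne2, hv k hkn (by omega)] at h
      · simp at h
      · intro e; rw [← e, pos_inl] at hzs; simp only at hzs; omega
  · rintro k hk ⟨hkn, h⟩
    change k < col (L (Sum.inr ⟨k, hkn⟩)) at h
    by_cases h1 : k = i
    · subst h1
      change _ < col (L t) at h
      rw [Lt] at h; simp at h
    · rw [Lo _ (by exact nofun) (by simpa [ht] using h1) (by exact nofun)] at h
      · have := hv k hkn (by omega)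
        rw [link_eq_comm] at this
        rw [← this] at h
        simp at h
      · intro e; rw [← e, pos_inr] at hzs; simp only [pt] at hzs; omega

/-- If the diagram links the bottom points `i + 1`, `i + 2` and not all previous columns are
vertical, then it is the product of `E (i + 1)` and of a diagram linking `i`, `i + 1`. -/
theorem exists_E_comp_of_not_vertical (d : Diagram n) (i j : Fin (n - 1)) (hij : j.val = i.val + 1)
    (hcup : d.link (hi j) = lo j) (hmin : ∀ k ≤ j.val, ¬ BottomLeft d k)
    (hv : ¬ ∀ (k : ℕ) (hk : k < n), k < j → d.link (Sum.inl ⟨k, hk⟩) = Sum.inr ⟨k, hk⟩) :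
    ∃ d' : Diagram n, comp (E j) d' = d ∧ d'.link (hi i) = lo i ∧ ¬ BottomLeft d' (j + 1) := by
  have e : lo j = hi i := by simp [lo, hi, hij]
  have hcup' : d.link (lo j) = hi j := by rw [← hcup, d.link_link]
  have hne : d.link (lo i) ≠ hi i := by
    rw [← e, Ne, link_eq_comm, hcup']; simp [lo, hi]; omega
  have hl := E_comp_link i d hne
  rw [← e, hcup'] at hl
  -- The choice of `d'` comes from the relation `E j * E i * E j = E j` for neighbouring indices: as
  -- `d` has the cup of `E j`, gluing `E i` and then `E j` below gives `d` back.
  set d' := comp (E i) d with hd'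
  have lh : lo i ≠ lo j := by rw [e]; exact lo_ne_hi i
  have l1 : d'.link (lo j) = lo i := by rw [hl, if_neg lh.symm, if_pos rfl]
  have h3 : hi j ≠ lo i := by simp [lo, hi]; omega
  have h4 := lo_ne_hi j
  have hu : d.link (lo i) ≠ hi j := by rw [Ne, link_eq_comm, hcup]; exact lh
  have l2 : d'.link (hi j) = d.link (lo i) := by
    rw [hl, if_neg h3, if_neg h4.symm, if_neg hu.symm, if_pos rfl]
  refine ⟨d', ?_, e ▸ l1, ?_⟩
  · have hne' : d'.link (lo j) ≠ hi j := by rw [l1]; exact h3.symm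
    ext1
    funext a
    rw [E_comp_link j d' hne', l1, l2]
    split_ifs with g1 g2 g3 g4
    · rw [g1, hcup']
    · rw [g2, hcup]
    · rw [g3]
    · rw [g4, d.link_link]
    · rw [hl, if_neg g3, if_neg g1, if_neg g4, if_neg g2]
  · rintro ⟨hjn, h⟩
    change col (d'.link (hi j)) < _ at h
    rw [l2] at h
    apply hv
    have hcl : i ≤ col (d.link (lo i)) := not_lt.1 fun h' => hmin i (by omega) ⟨by omega, h'⟩
    have hs := d.link_ne (lo i)
    -- the partner of the bottom point `i` is a top point
    rcases hm : d.link (lo i) with m | m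
    · rw [hm] at h hcl hs hne
      rw [Ne, inl_eq_lo] at hs
      rw [Ne, inl_eq_hi] at hne
      simp only [col_inl] at h hcl
      omega
    -- At this point `m` is `i` or `i + 1`; parity excludes `i + 1`.
    have hpar := odd_pos_add_pos_link d (lo i) (by rw [hm]; simp; omega)
    rw [hm] at hpar h hcl
    simp only [pos_lo, pos_inr, col_inr] at hpar h hcl
    have hmi : m.val = i := by omega
    -- Verticality spreads leftwards from column `i`: the vertical link at `k + 1` confines the
    -- partner of bottom `k` to columns at most `k + 1`, and minimality keeps it out of smaller
    -- ones. This contradicts `hv`.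
    have key : ∀ s k : ℕ, ∀ hk : k < n, k + s = i →
        d.link (Sum.inl ⟨k, hk⟩) = Sum.inr ⟨k, hk⟩ := by
      intro s
      induction s with
      | zero =>
        intro k hk hks
        obtain rfl : k = i := by omega
        change d.link (lo i) = _
        rw [hm]; simp [Fin.ext_iff, hmi]
      | succ s ih =>
        intro k hk hks
        have hk1 := ih (k + 1) (by omega) (by omega)
        have c1 : k ≤ col (d.link (Sum.inl ⟨k, hk⟩)) :=
          not_lt.1 fun h' => hmin k (by omega) ⟨hk, h'⟩
        have c2 := d.noncrossing (Sum.inl ⟨k, hk⟩) (Sum.inl ⟨k + 1, by omega⟩)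
        have c3 := d.link_ne (Sum.inl ⟨k, hk⟩)
        rw [hk1] at c2
        rcases hq : d.link (Sum.inl ⟨k, hk⟩) with q | q
        · exfalso
          rw [hq] at c1 c2 c3
          have : d.link (Sum.inl ⟨k, hk⟩) ≠ Sum.inl ⟨k + 1, by omega⟩ := by
            rw [Ne, link_eq_comm, hk1]; exact nofun
          rw [hq] at this
          simp only [Ne, Sum.inl.injEq, Fin.ext_iff, pos_inl, pos_inr, col_inl] at *
          omega
        · have : d.link (Sum.inl ⟨k, hk⟩) ≠ Sum.inr ⟨k + 1, by omega⟩ := by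
            rw [← hk1]; intro h'; simpa using d.link_injective h'
          rw [hq] at this c1 c2
          simp only [Ne, Sum.inr.injEq, Fin.ext_iff, pos_inl, pos_inr, col_inr] at *
          omega
    intro k hk hki
    exact key (i - k) k hk (by omega)

end Diagram
end TemperleyLieb

/-! ### Antidiagonal words, and products with bubbles. -/

namespace TemperleyLieb
open Diagram

variable {n : ℕ}

theorem antidiagonal_self (i : Fin (n - 1)) : antidiagonal i i = [i] := by
  refine List.SortedGT.eq_of_mem_iff ?_ (by simp [List.sortedGT_iff_pairwise]) fun k => ?_
  · rw [List.sortedGT_iff_pairwise]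
    exact ((List.sortedLT_finRange _).reverse.pairwise).filter _
  · simp only [antidiagonal, List.mem_filter, List.mem_reverse, List.mem_finRange, true_and,
      decide_eq_true_eq, List.mem_singleton, Fin.le_def, Fin.ext_iff]
    omega

theorem antidiagonal_succ {i i' j : Fin (n - 1)} (h : i'.val = i.val + 1) (hj : j ≤ i) :
    antidiagonal i' j = i' :: antidiagonal i j := by
  refine List.SortedGT.eq_of_mem_iff ?_ ?_ fun k => ?_
  · rw [List.sortedGT_iff_pairwise]
    exact ((List.sortedLT_finRange _).reverse.pairwise).filter _
  · rw [List.sortedGT_iff_pairwise, List.pairwise_cons]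
    refine ⟨fun k hk => ?_, ((List.sortedLT_finRange _).reverse.pairwise).filter _⟩
    simp only [antidiagonal, List.mem_filter, List.mem_reverse, List.mem_finRange, true_and,
      decide_eq_true_eq, Fin.le_def, Fin.lt_def] at hk ⊢
    omega
  · simp only [antidiagonal, List.mem_filter, List.mem_reverse, List.mem_finRange, true_and,
      decide_eq_true_eq, List.mem_cons, Fin.le_def, Fin.ext_iff] at hj ⊢
    omega

namespace BubbleDiagram

theorem of_mul_of {d e : Diagram n} (h : Diagram.bubbles d e = 0) :
    of d * of e = of (comp d e) := by
  refine BubbleDiagram.ext ?_ rfl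
  change 0 + 0 + Diagram.bubbles d e = 0
  rw [h]

theorem of_injective : Function.Injective (of (n := n)) := fun _ _ h =>
  congrArg BubbleDiagram.diagram h

theorem bubble_pow_mul_of (p : ℕ) (d : Diagram n) : bubble n ^ p * of d = ⟨p, d⟩ := by
  have mul_mk : ∀ q (e : Diagram n), bubble n * (⟨q, e⟩ : BubbleDiagram n) = ⟨q + 1, e⟩ := by
    intro q e
    refine BubbleDiagram.ext ?_ (straight_comp e)
    change 1 + q + Diagram.bubbles (straight n) e = q + 1
    rw [bubbles_straight_left]; omega
  induction p with
  | zero => rw [pow_zero, one_mul]; rfl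
  | succ p ih => rw [pow_succ', mul_assoc, ih, mul_mk]

/-- The monoid homomorphism replacing each bubble by the scalar `δ`. -/
noncomputable def evalHom (n : ℕ) (δ : ℂ) : BubbleDiagram n →* DiagramAlgebra n δ where
  toFun x := δ ^ x.bubbles • DiagramAlgebra.of δ x.diagram
  map_one' := by
    change δ ^ 0 • DiagramAlgebra.of δ (straight n) = DiagramAlgebra.of δ (straight n)
    rw [pow_zero, one_smul]
  map_mul' x y := by
    rw [smul_mul_smul_comm]
    change δ ^ (x.bubbles + y.bubbles + Diagram.bubbles x.diagram y.diagram) •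
        DiagramAlgebra.of δ (comp x.diagram y.diagram) = _ •
        DiagramAlgebra.mulMap n δ (DiagramAlgebra.of δ x.diagram) (DiagramAlgebra.of δ y.diagram)
    rw [DiagramAlgebra.mulMap_of, smul_smul, pow_add, pow_add]

theorem evalHom_of (δ : ℂ) (d : Diagram n) : evalHom n δ (of d) = DiagramAlgebra.of δ d := by
  change δ ^ 0 • DiagramAlgebra.of δ d = _
  rw [pow_zero, one_smul]

end BubbleDiagram

/-! ### The diagram of a Jones normal form determines its indices. -/

namespace JonesForm

/-- Transfers the bubble-free computation in the monoid to the algebra. -/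
theorem toAlgebra_eq (δ : ℂ) (w : JonesForm n) :
    w.toAlgebra δ = BubbleDiagram.evalHom n δ w.toBubbleDiagram := by
  rw [toAlgebra, toBubbleDiagram, map_list_prod, List.map_map]
  congr 2
  funext k
  exact (BubbleDiagram.evalHom_of δ _).symm

/-- The diagram `d` is the product of the blocks of `w`, whose indices are the columns of the
points linked to the left on the bottom side and to the right on the top side. -/
structure Represents (w : JonesForm n) (d : Diagram n) : Prop where
  eq : w.toBubbleDiagram = BubbleDiagram.of d
  bottomLeft : ∀ k, BottomLeft d k ↔ ∃ b ∈ w.blocks, k = b.1.val + 1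
  topRight : ∀ k, TopRight d k ↔ ∃ b ∈ w.blocks, k = b.2.val

/-- The Jones normal form with a block added in front. -/
def cons (i j : Fin (n - 1)) (w : JonesForm n) (hj : j ≤ i)
    (h : ∀ b ∈ w.blocks, i < b.1 ∧ j < b.2) : JonesForm n where
  blocks := (i, j) :: w.blocks
  le := List.forall_mem_cons.2 ⟨hj, w.le⟩
  increasing := List.pairwise_cons.2 ⟨h, w.increasing⟩

/-- The empty Jones normal form. -/
def empty (n : ℕ) : JonesForm n := ⟨[], by simp, .nil⟩

theorem toBubbleDiagram_cons_self (i : Fin (n - 1)) (w : JonesForm n)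
    (h : ∀ b ∈ w.blocks, i < b.1 ∧ i < b.2) :
    (w.cons i i le_rfl h).toBubbleDiagram = BubbleDiagram.of (E i) * w.toBubbleDiagram := by
  simp [toBubbleDiagram, letters, cons, antidiagonal_self]

theorem toBubbleDiagram_cons_succ {i i' j : Fin (n - 1)} (hii : i'.val = i.val + 1)
    (w : JonesForm n) (hj : j ≤ i) (hj' : j ≤ i') (h : ∀ b ∈ w.blocks, i < b.1 ∧ j < b.2)
    (h' : ∀ b ∈ w.blocks, i' < b.1 ∧ j < b.2) :
    (w.cons i' j hj' h').toBubbleDiagram =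
      BubbleDiagram.of (E i') * (w.cons i j hj h).toBubbleDiagram := by
  simp [toBubbleDiagram, letters, cons, antidiagonal_succ hii hj]

theorem represents_empty : (empty n).Represents (straight n) where
  eq := rfl
  bottomLeft k := by simp [empty, BottomLeft, straight]
  topRight k := by simp [empty, TopRight, straight]

/-- All top-right columns of `d` exceed `i`, so column `i` is vertical and the new generator opens a
block. -/
theorem Represents.cons_self {w : JonesForm n} {d : Diagram n} (hw : w.Represents d)
    (i : Fin (n - 1)) (h : ∀ b ∈ w.blocks, i < b.1 ∧ i < b.2) :
    (w.cons i i le_rfl h).Represents (comp (E i) d) := by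
  obtain ⟨h1, h2, h3⟩ := E_comp_of_vertical d i
    (vertical_of_not_topRight d i (fun k hk hd => by
      obtain ⟨b, hb, rfl⟩ := (hw.topRight k).1 hd
      have := (h b hb).2
      omega) i (by omega) le_rfl)
    (fun hd => by
      obtain ⟨b, hb, e⟩ := (hw.bottomLeft _).1 hd
      have := (h b hb).1
      omega)
  refine ⟨?_, fun k => ?_, fun k => ?_⟩
  · rw [toBubbleDiagram_cons_self, hw.eq, BubbleDiagram.of_mul_of h1]
  · rw [h2, hw.bottomLeft]; simp [cons]
  · rw [h3, hw.topRight]; simp [cons]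

/-- The first block contributes the smallest bottom-left column `i + 1`, hence a cup at `i`, `i +
1`. The new generator moves that column to `i' + 1` and leaves the top-right columns alone. -/
theorem Represents.cons_succ {w : JonesForm n} {d : Diagram n} {i i' j : Fin (n - 1)}
    (hii : i'.val = i.val + 1) (hj : j ≤ i) (hj' : j ≤ i')
    (h : ∀ b ∈ w.blocks, i < b.1 ∧ j < b.2) (h' : ∀ b ∈ w.blocks, i' < b.1 ∧ j < b.2)
    (hw : (w.cons i j hj h).Represents d) :
    (w.cons i' j hj' h').Represents (comp (E i') d) := by
  have hb := hw.bottomLeft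
  have ht := hw.topRight
  simp only [cons, List.mem_cons, exists_eq_or_imp] at hb ht
  have hcup : d.link (hi i) = lo i := by
    refine link_hi_of_minimal d i (fun k hk hd => ?_) ((hb _).2 (.inl rfl))
    obtain h | ⟨b, hb, e⟩ := (hb k).1 hd
    · omega
    · have := (h b hb).1
      omega
  obtain ⟨h1, h2, h3⟩ := E_comp_of_cup d i i' hii hcup (fun hd => by
    obtain h | ⟨b, hb, e⟩ := (hb _).1 hd
    · omega
    · have := (h' b hb).1
      omega)
  refine ⟨?_, fun k => ?_, fun k => ?_⟩
  · rw [toBubbleDiagram_cons_succ hii w hj hj' h h', hw.eq, BubbleDiagram.of_mul_of h1]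
  · rw [h2, hb]
    simp only [cons, List.mem_cons, exists_eq_or_imp]
    refine or_congr_right ⟨?_, ?_⟩
    · rintro ⟨h | h, h'⟩
      · omega
      · exact h
    · rintro ⟨b, hb, rfl⟩
      refine ⟨.inr ⟨b, hb, rfl⟩, ?_⟩
      have := (h' b hb).1
      omega
  · rw [h3, ht]
    simp [cons]

/-- Induction on the blocks, then on the length of the first one, grown from its last letter `E j`
up to `E i`. -/
theorem exists_represents (w : JonesForm n) : ∃ d, w.Represents d := by
  obtain ⟨L, hle, hinc⟩ := w
  induction L with
  | nil => exact ⟨_, represents_empty⟩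
  | cons b L ih =>
    obtain ⟨i, j⟩ := b
    have hj : j ≤ i := hle _ List.mem_cons_self
    have hle' := (List.forall_mem_cons.1 hle).2
    have hinc' := (List.pairwise_cons.1 hinc).2
    have hb := (List.pairwise_cons.1 hinc).1
    obtain ⟨d, hd⟩ := ih hle' hinc'
    have key : ∀ (s : ℕ) (m : Fin (n - 1)), m.val = j.val + s → ∀ (hjm : j ≤ m)
        (hm : ∀ b ∈ L, m < b.1 ∧ j < b.2),
        ∃ d, ((⟨L, hle', hinc'⟩ : JonesForm n).cons m j hjm hm).Represents d := by
      intro s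
      induction s with
      | zero =>
        intro m hmj hjm hm
        obtain rfl : m = j := Fin.ext hmj
        exact ⟨_, hd.cons_self m hm⟩
      | succ s ih =>
        intro m hmj hjm hm
        have hlt : ∀ b ∈ L, (⟨j + s, by omega⟩ : Fin (n - 1)) < b.1 ∧ j < b.2 := fun b hb =>
          ⟨lt_trans (Fin.lt_def.2 (by simp only; omega)) (hm b hb).1, (hm b hb).2⟩
        have hjs : j ≤ (⟨j + s, by omega⟩ : Fin (n - 1)) := Fin.le_def.2 (by simp)
        obtain ⟨d', hd'⟩ := ih ⟨j + s, by omega⟩ rfl hjs hlt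
        exact ⟨_, hd'.cons_succ (by simp only; omega) hjs hjm hlt hm⟩
    exact key (i - j) i (by have := Fin.le_def.1 hj; omega) hj hb

/-- A strictly increasing list is determined by its members, here the bottom-left columns (shifted
by one) and the top-right columns of `d`. -/
theorem Represents.unique {w w' : JonesForm n} {d : Diagram n} (h : w.Represents d)
    (h' : w'.Represents d) : w = w' := by
  have h1 : w.blocks.map Prod.fst = w'.blocks.map Prod.fst := by
    refine List.Pairwise.eq_of_mem_iff (r := (· < ·))
      (List.pairwise_map.2 (w.increasing.imp And.left))
      (List.pairwise_map.2 (w'.increasing.imp And.left)) fun k => ?_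
    have := (h.bottomLeft (k + 1)).symm.trans (h'.bottomLeft (k + 1))
    simp only [Nat.add_right_cancel_iff, ← Fin.ext_iff] at this
    simpa [eq_comm] using this
  have h2 : w.blocks.map Prod.snd = w'.blocks.map Prod.snd := by
    refine List.Pairwise.eq_of_mem_iff (r := (· < ·))
      (List.pairwise_map.2 (w.increasing.imp And.right))
      (List.pairwise_map.2 (w'.increasing.imp And.right)) fun k => ?_
    have := (h.topRight k).symm.trans (h'.topRight k)
    simp only [← Fin.ext_iff] at this
    simpa [eq_comm] using this
  ext1
  rw [← List.zip_unzip w.blocks, ← List.zip_unzip w'.blocks, List.unzip_eq_map, List.unzip_eq_map,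
    h1, h2]

end JonesForm

/-! ### Every diagram has a Jones normal form, by descent on the weight. -/

namespace Diagram
open Classical in
/-- The sum of the columns of the bottom points linked to the left. -/
noncomputable def weight (d : Diagram n) : ℕ := ∑ k ∈ Finset.range n with BottomLeft d k, k

theorem weight_lt_of_vertical {d d' : Diagram n} {i : ℕ} (hi : i + 1 < n)
    (h : ∀ k, BottomLeft d k ↔ k = i + 1 ∨ BottomLeft d' k) (h' : ¬ BottomLeft d' (i + 1)) :
    weight d' < weight d := by
  classical
  refine Finset.sum_lt_sum_of_subset (i := i + 1) (fun k hk => ?_) ?_ ?_ (Nat.succ_pos i)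
    fun _ _ _ => Nat.zero_le _
  · simp only [Finset.mem_filter] at hk ⊢
    exact ⟨hk.1, (h k).2 (.inr hk.2)⟩
  · simp only [Finset.mem_filter, Finset.mem_range]
    exact ⟨hi, (h _).2 (.inl rfl)⟩
  · simp [h']

/-- Removing `E j` turns the summand `j + 1` back into `j`. -/
theorem weight_lt_of_cup {d d' : Diagram n} {j : ℕ} (hj : j + 1 < n)
    (h : ∀ k, BottomLeft d k ↔ k = j + 1 ∨ BottomLeft d' k ∧ k ≠ j) (h1 : BottomLeft d' j)
    (h2 : ¬ BottomLeft d' (j + 1)) : weight d' < weight d := by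
  classical
  have e : (Finset.range n).filter (BottomLeft d) =
      insert (j + 1) (((Finset.range n).filter (BottomLeft d')).erase j) := by
    ext k
    simp only [Finset.mem_filter, Finset.mem_range, Finset.mem_insert, Finset.mem_erase, h]
    constructor
    · tauto
    · rintro (rfl | h)
      exacts [⟨hj, .inl rfl⟩, ⟨h.2.1, .inr ⟨h.2.2, h.1⟩⟩]
  have hmem : j ∈ (Finset.range n).filter (BottomLeft d') := by
    simp only [Finset.mem_filter, Finset.mem_range]
    exact ⟨by omega, h1⟩
  unfold weight
  rw [e, Finset.sum_insert (by simp [h2]), ← Finset.add_sum_erase _ _ hmem]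
  omega

theorem exists_jonesForm (d : Diagram n) : ∃ w : JonesForm n, w.Represents d := by
  classical
  induction hN : weight d using Nat.strong_induction_on generalizing d with | _ N ih
  subst hN
  by_cases h0 : ∀ k, ¬ BottomLeft d k
  · rw [eq_straight d h0]
    exact ⟨_, JonesForm.represents_empty⟩
  push Not at h0
  -- The smallest bottom-left column is written `j + 1`, which is possible since column 0 has
  -- nothing to its left.
  obtain ⟨j, hj, hmin⟩ : ∃ j : Fin (n - 1), BottomLeft d (j + 1) ∧ ∀ k ≤ j.val, ¬ BottomLeft d k := by
    have hf := Nat.find_spec h0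
    have hm := fun k => Nat.find_min (m := k) h0
    generalize Nat.find h0 = m at hf hm
    have : m ≠ 0 := fun e => not_bottomLeft_zero d (e ▸ hf)
    obtain ⟨m, rfl⟩ := Nat.exists_eq_succ_of_ne_zero this
    exact ⟨⟨m, by have := hf.1; omega⟩, hf, fun k hk => hm k (Nat.lt_succ_of_le hk)⟩
  have hcup := link_hi_of_minimal d j hmin hj
  by_cases hv : ∀ (k : ℕ) (hk : k < n), k < j → d.link (Sum.inl ⟨k, hk⟩) = Sum.inr ⟨k, hk⟩
  · obtain ⟨d', rfl, h1, h2, h3⟩ := exists_E_comp_of_vertical d j hcup hv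
    have hbl := (E_comp_of_vertical d' j h3 (h1 _ le_rfl)).2.1
    obtain ⟨w, hw⟩ := ih _ (weight_lt_of_vertical (by omega) hbl (h1 _ le_rfl)) d' rfl
    -- The remaining diagram has no bottom-left column up to `j + 1` and no top-right column up to
    -- `j`, so all indices of `w` exceed `j`.
    refine ⟨_, hw.cons_self j fun b hb => ⟨?_, ?_⟩⟩
    · by_contra hlt
      exact h1 (b.1 + 1) (by rw [Fin.lt_def] at hlt; omega) ((hw.bottomLeft _).2 ⟨b, hb, rfl⟩)
    · by_contra hlt
      exact h2 b.2 (not_lt.1 hlt) ((hw.topRight _).2 ⟨b, hb, rfl⟩)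
  -- For `j = 0` no column precedes, so verticality would hold vacuously.
  · obtain ⟨i, hij⟩ : ∃ i : Fin (n - 1), j.val = i.val + 1 := by
      rcases hj0 : j.val with _ | m
      · exact absurd (fun k hk hkj => by omega) hv
      · exact ⟨⟨m, by omega⟩, rfl⟩
    obtain ⟨d', rfl, hcup', h1⟩ := exists_E_comp_of_not_vertical d i j hij hcup hmin hv
    have hbl := (E_comp_of_cup d' i j hij hcup' h1).2.1
    have hj' : BottomLeft d' j := by
      rw [hij]
      refine ⟨by omega, ?_⟩
      change col (d'.link (hi i)) < _
      rw [hcup']; simp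
    obtain ⟨w, hw⟩ := ih _ (weight_lt_of_cup (by omega) hbl hj' h1) d' rfl
    obtain ⟨b, hb, hbj⟩ := (hw.bottomLeft j).1 hj'
    obtain ⟨_ | ⟨⟨a, c⟩, L⟩, hle, hinc⟩ := w
    · simp at hb
    -- The first block of `w` must begin with `i`: some block begins with `i`, and an earlier start
    -- `a < i` would leave the bottom-left column `a + 1 < j + 1` in the original diagram, against
    -- minimality.
    have ha : a = i := by
      have h4 : a ≤ b.1 := by
        rcases List.mem_cons.1 hb with rfl | hb
        · exact le_rfl
        · exact ((List.pairwise_cons.1 hinc).1 b hb).1.le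
      rw [Fin.le_def] at h4
      by_contra hne
      rw [Fin.ext_iff] at hne
      refine hmin (a + 1) (by omega) ((hbl _).2 (.inr ⟨?_, by omega⟩))
      exact (hw.bottomLeft _).2 ⟨_, List.mem_cons_self, rfl⟩
    subst ha
    have hc : c ≤ a := hle _ List.mem_cons_self
    have hL := (List.pairwise_cons.1 hinc).1
    refine ⟨_, JonesForm.Represents.cons_succ
      (w := ⟨L, (List.forall_mem_cons.1 hle).2, (List.pairwise_cons.1 hinc).2⟩) hij hc
      (hc.trans (Fin.le_def.2 (by omega))) hL (fun b hb => ⟨?_, (hL b hb).2⟩) hw⟩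
    have h5 := (hL b hb).1
    -- Later blocks begin above `i`, and not at `j` because `j + 1` is not bottom-left in `d'`;
    -- hence they begin above `j` and the lengthened block stays admissible.
    have h6 : b.1.val ≠ j := fun e =>
      h1 (e ▸ (hw.bottomLeft _).2 ⟨b, List.mem_cons_of_mem _ hb, rfl⟩)
    rw [Fin.lt_def] at h5 ⊢
    simp only at h5
    omega

end Diagram

/-! ### Bijection between normal forms and diagrams, and the basis. -/

namespace JonesForm

/-- The diagram of a Jones normal form. -/
noncomputable def diagram (w : JonesForm n) : Diagram n := w.exists_represents.choose

theorem represents_diagram (w : JonesForm n) : w.Represents w.diagram :=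
  w.exists_represents.choose_spec

/-- The form `w` already represents some diagram, and the monoid equality identifies it with `d`;
the column descriptions thus come for free. -/
theorem represents_of_eq {w : JonesForm n} {d : Diagram n}
    (h : w.toBubbleDiagram = BubbleDiagram.of d) : w.Represents d := by
  have := BubbleDiagram.of_injective (w.represents_diagram.eq.symm.trans h)
  exact this ▸ w.represents_diagram

theorem diagram_bijective : Function.Bijective (diagram (n := n)) := by
  refine ⟨fun w w' h => w.represents_diagram.unique (h ▸ w'.represents_diagram), fun d => ?_⟩
  obtain ⟨w, hw⟩ := d.exists_jonesForm
  exact ⟨w, BubbleDiagram.of_injective (w.represents_diagram.eq.symm.trans hw.eq)⟩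

end JonesForm

/-- The basis of the diagrammatic algebra given by the diagrams. -/
noncomputable def DiagramAlgebra.basis (n : ℕ) (δ : ℂ) :
    Module.Basis (Diagram n) ℂ (DiagramAlgebra n δ) :=
  .ofRepr (LinearEquiv.refl ℂ (Diagram n →₀ ℂ))

theorem DiagramAlgebra.basis_apply (δ : ℂ) (d : Diagram n) :
    DiagramAlgebra.basis n δ d = DiagramAlgebra.of δ d := rfl

end TemperleyLieb

theorem mainTheorem2 (n : ℕ) (hn : 1 ≤ n) (δ : ℂ) (hδ : δ ≠ 0) :
    (∀ (p p' : ℕ) (w w' : TemperleyLieb.JonesForm n),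
      TemperleyLieb.BubbleDiagram.bubble n ^ p * w.toBubbleDiagram =
        TemperleyLieb.BubbleDiagram.bubble n ^ p' * w'.toBubbleDiagram → p = p' ∧ w = w') ∧
    (∀ d : TemperleyLieb.Diagram n,
      ∃! w : TemperleyLieb.JonesForm n, w.toBubbleDiagram = TemperleyLieb.BubbleDiagram.of d) ∧
    ∃ b : Module.Basis (TemperleyLieb.JonesForm n) ℂ (TemperleyLieb.DiagramAlgebra n δ),
      ∀ w, b w = w.toAlgebra δ := by
  refine ⟨fun p p' w w' h => ?_, fun d => ?_, ?_⟩
  · rw [w.represents_diagram.eq, w'.represents_diagram.eq,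
      TemperleyLieb.BubbleDiagram.bubble_pow_mul_of,
      TemperleyLieb.BubbleDiagram.bubble_pow_mul_of, TemperleyLieb.BubbleDiagram.mk.injEq] at h
    exact ⟨h.1, TemperleyLieb.JonesForm.diagram_bijective.1 h.2⟩
  · obtain ⟨w, hw⟩ := d.exists_jonesForm
    exact ⟨w, hw.eq, fun w' hw' => (TemperleyLieb.JonesForm.represents_of_eq hw').unique hw⟩
  -- No bubble arises in these products, so each is exactly a basis diagram, with no power of `δ`.
  · refine ⟨(TemperleyLieb.DiagramAlgebra.basis n δ).reindex
      (Equiv.ofBijective _ TemperleyLieb.JonesForm.diagram_bijective).symm, fun w => ?_⟩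
    rw [Module.Basis.reindex_apply, Equiv.symm_symm, Equiv.ofBijective_apply,
      TemperleyLieb.DiagramAlgebra.basis_apply, w.toAlgebra_eq, w.represents_diagram.eq,
      TemperleyLieb.BubbleDiagram.evalHom_of]
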